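/- Let $k\ge 1$ and let $U:\mathbb{Z}^k\to[0,\infty)$ satisfy $U(-j)=U(j)$ for all $j$, $U(0)=0$ and $v:=\inf_{j\in\mathbb{Z}^k\setminus\{0\}}U(j)>0$. For $\beta\in\mathbb{R}$ put $Q_\beta(j)=e^{-\beta U(j)}$, $j\in\mathbb{Z}^k$. Fix $A>1/v$ and set $\beta_{A,d}=A\log d/(d+1)$ for integers $d\ge 2$. Assume that $$\|Q_{\beta_{A,d}}\|_{\frac{d+1}{2},\mathbb{Z}^k}=\Big(\sum_{j\in\mathbb{Z}^k}Q_{\beta_{A,d}}(j)^{\frac{d+1}{2}}\Big)^{\frac{2}{d+1}}<\infty\quad\text{for some integer } d\ge 2 .$$ For a tree with vertex set $V$ in which every vertex has exactly $d+1$ neighbours, a Gibbs measure for $Q_\beta$ means a probability measure $\mu$ on $(\mathbb{Z}^k)^V$ (with the product $\sigma$-algebra) such that $\mu\gamma_\Lambda=\mu$ for every finite $\Lambda\subset V$, where $\gamma_\Lambda(\cdot\mid\omega)$ keeps the spins of $\omega$ outside $\Lambda$ and $$\gamma_\Lambda(\sigma_\Lambda=\omega_\Lambda\mid\omega)=Z_\Lambda(\omega)^{-1}\prod_{b=\{x,y\}:\,b\cap\Lambda\ne\emptyset}Q_\beta(\omega_x-\omega_y),$$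 the product being over the edges $b$ of the tree that meet $\Lambda$; it is part of the definition that the partition functions $Z_\Lambda(\omega)$ are finite and positive for all finite $\Lambda$ and all $\omega$. Then there are an integer $d_0\ge 2$ and a constant $C>0$ such that for all $d\ge d_0$, on the tree in which every vertex has $d+1$ neighbours, and for all $\beta\ge\beta_{A,d}$, there is a family $(\mu_i)_{i\in\mathbb{Z}^k}$ of pairwise distinct Gibbs measures for $Q_\beta$, each invariant under all automorphisms of the tree, such that for every $i\in\mathbb{Z}^k$ and every vertex $x$ (by invariance, equivalently, for a fixed root $x=0$) one has $\mu_i(\sigma_x=i)>0$ and $$\frac{\mu_i(\sigma_x\neq i)}{\mu_i(\sigma_x=i)}\le\frac{C}{d}.$$ -/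

import Mathlib

open scoped ENNReal

noncomputable section

namespace TreeGibbs

/-- The local state space `ℤ^k`. It carries the discrete sigma-algebra. -/
abbrev Spin (k : ℕ) : Type := Fin k → ℤ

/-- The configuration space `(ℤ^k)^V`. It carries the product sigma-algebra. -/
abbrev Config (V : Type*) (k : ℕ) : Type _ := V → Spin k

/-- The transfer operator `Q_β(j) = exp (-β U(j))`. -/
def transferOp {k : ℕ} (U : Spin k → ℝ) (β : ℝ) (j : Spin k) : ℝ :=
  Real.exp (-β * U j)

theorem transferOp_even {k : ℕ} {U : Spin k → ℝ} (hU : Function.Even U) (β : ℝ) :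
    Function.Even (transferOp U β) := by
  intro j
  simp only [transferOp, hU j]

/-- The inverse temperature `β_{A,d} = A log d / (d + 1)`. -/
def thresholdBeta (A : ℝ) (d : ℕ) : ℝ := A * Real.log d / ((d : ℝ) + 1)

section Specification

variable {V : Type*} {k : ℕ}

/-- The weight `Q_b(ω_b) = Q(ω_x - ω_y)` of an unoriented edge `b = {x, y}`; it does not depend
on the orientation since `Q` is even. -/
def edgeWeight (Q : Spin k → ℝ) (hQ : Function.Even Q) (ω : Config V k) (b : Sym2 V) : ℝ :=
  Sym2.lift ⟨fun x y => Q (ω x - ω y), fun x y => by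
    simpa only [neg_sub] using hQ (ω y - ω x)⟩ b

open Classical in
/-- The finite set of all edges `b` of `G` with `b ∩ Λ ≠ ∅`. -/
def edgesMeeting (G : SimpleGraph V) [G.LocallyFinite] (Λ : Finset V) : Finset (Sym2 V) :=
  Λ.biUnion fun x => G.incidenceFinset x

/-- The Boltzmann weight `∏_{b ∩ Λ ≠ ∅} Q_b(ω_b)`. -/
def boltzmannWeight (G : SimpleGraph V) [G.LocallyFinite] (Q : Spin k → ℝ)
    (hQ : Function.Even Q) (Λ : Finset V) (ω : Config V k) : ℝ≥0∞ :=
  ENNReal.ofReal (∏ b ∈ edgesMeeting G Λ, edgeWeight Q hQ ω b)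

open Classical in
/-- The configuration that equals `η` on `Λ` and `ω` off `Λ`. -/
def glue (Λ : Finset V) (η : Λ → Spin k) (ω : Config V k) : Config V k :=
  fun x => if h : x ∈ Λ then η ⟨x, h⟩ else ω x

/-- The partition function `Z_Λ(ω)`, the sum of the Boltzmann weights over all configurations
in `Λ` with boundary condition `ω`. -/
def partitionFunction (G : SimpleGraph V) [G.LocallyFinite] (Q : Spin k → ℝ)
    (hQ : Function.Even Q) (Λ : Finset V) (ω : Config V k) : ℝ≥0∞ :=
  ∑' η : Λ → Spin k, boltzmannWeight G Q hQ Λ (glue Λ η ω)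

/-- The kernel `γ_Λ(· | ω)` of the Gibbsian specification: the spins off `Λ` are those of `ω`,
and the spins in `Λ` equal `η` with probability
`Z_Λ(ω)⁻¹ ∏_{b ∩ Λ ≠ ∅} Q_b((η ω_{Λᶜ})_b)`. -/
def gibbsKernel (G : SimpleGraph V) [G.LocallyFinite] (Q : Spin k → ℝ)
    (hQ : Function.Even Q) (Λ : Finset V) (ω : Config V k) :
    MeasureTheory.Measure (Config V k) :=
  MeasureTheory.Measure.sum fun η : Λ → Spin k =>
    ((partitionFunction G Q hQ Λ ω)⁻¹ * boltzmannWeight G Q hQ Λ (glue Λ η ω)) •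
      MeasureTheory.Measure.dirac (glue Λ η ω)

/-- `μ` is a Gibbs measure for the transfer operator `Q` on `G`: the specification is well
defined, i.e. all partition functions are finite and positive, `μ` is a probability measure, and
`μ` satisfies the DLR equations `μ γ_Λ = μ` for all finite `Λ ⊆ V`. -/
structure IsGibbsMeasure (G : SimpleGraph V) [G.LocallyFinite] (Q : Spin k → ℝ)
    (hQ : Function.Even Q) (μ : MeasureTheory.Measure (Config V k)) : Prop where
  partitionFunction_ne_zero : ∀ Λ ω, partitionFunction G Q hQ Λ ω ≠ 0
  partitionFunction_ne_top : ∀ Λ ω, partitionFunction G Q hQ Λ ω ≠ ∞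
  isProbabilityMeasure : MeasureTheory.IsProbabilityMeasure μ
  dlr : ∀ (Λ : Finset V) (S : Set (Config V k)), MeasurableSet S →
    ∫⁻ ω, gibbsKernel G Q hQ Λ ω S ∂μ = μ S

/-- Invariance of `μ` under all automorphisms of the graph. -/
def IsAutomorphismInvariant (G : SimpleGraph V) (μ : MeasureTheory.Measure (Config V k)) : Prop :=
  ∀ φ : G ≃g G, μ.map (fun (σ : Config V k) (x : V) => σ (φ x)) = μ

end Specification

end TreeGibbs

end

/-! A positive summable solution `u` of the boundary law equation `Q * u ^ d = N u` with `∑ u ^ (d +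
1) = Z < ∞` yields a Gibbs measure: the tree-indexed Markov chain with one-site law `u ^ (d + 1) /
Z` and transitions `Q (a - b) u b ^ d / (N u a)` (`exists_isGibbsMeasure_of_boundaryLaw`). The chain
is reversible, so its finite-dimensional densities do not refer to the root; this gives invariance
under automorphisms. The DLR equations hold because the vertex factors and the dressings of the
edges cancel, up to a constant, at every vertex all of whose edges are counted.

A boundary law concentrated at the origin comes from a fixed point (`exists_boundaryLaw`). Normalize
`u 0 = 1` and let `w` be `u` off the origin. The recursion for `w` acts on the set `∑ w ^ (d - 1) ≤
δ` with `δ = 1 / (8 d)`. It halves uniform distances, since differences of `d`-th powers are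
controlled by `(d - 1)`-th powers and `d δ` is small. It preserves the set if `∑_{j ≠ 0} Q j ^ (d -
1) ≤ δ / 6`. For large `d` this smallness holds: `(d - 1) β` is at least about `A log d`, and so the
sum is of order at most about `d ^ (-A v)` with `A v > 1` (`eventually_exp_thresholdBeta_le`,
`sum_transferOp_pow_le`).

Translating `u` by `i` gives `μ i`, for which `μ i (σ x = i) = 1 / Z` with `Z ≤ 1 + δ`. The odds are
then `Z - 1 ≤ 1 / (8 d)`, and a majority spin determines `i`. -/

namespace TreeGibbs

/-! ### Rooted trees: parents, root-closed sets, and products over edges. -/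

section Tree

variable {V : Type*} {G : SimpleGraph V}

theorem exists_adj_dist_eq (hG : G.Connected) {o x : V} (hx : x ≠ o) :
    ∃ y, G.Adj x y ∧ G.dist o x = G.dist o y + 1 := by
  obtain ⟨p, hp⟩ := hG.exists_walk_length_eq_dist x o
  cases p with
  | nil => exact absurd rfl hx
  | cons h p =>
    rename_i y
    refine ⟨y, h, ?_⟩
    have h1 : G.dist y o ≤ p.length := G.dist_le p
    have h2 : G.dist x o ≤ G.dist x y + G.dist y o := hG.dist_triangle
    rw [SimpleGraph.dist_eq_one_iff_adj.2 h] at h2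
    rw [SimpleGraph.Walk.length_cons] at hp
    rw [G.dist_comm (u := o), G.dist_comm (u := o)]
    omega

/-- Each of the two neighbours is the first step of a geodesic from `x` to `o`, and a tree has only
one path between two vertices. -/
theorem adj_dist_eq_unique (hG : G.IsTree) {o x y z : V} (hy : G.Adj x y) (hz : G.Adj x z)
    (hdy : G.dist o x = G.dist o y + 1) (hdz : G.dist o x = G.dist o z + 1) : y = z := by
  have key : ∀ w, G.Adj x w → G.dist o x = G.dist o w + 1 →
      ∃ p : G.Walk x o, p.IsPath ∧ p.snd = w := by
    intro w hw hd
    obtain ⟨p, hp⟩ := hG.connected.exists_walk_length_eq_dist w o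
    refine ⟨SimpleGraph.Walk.cons hw p, ?_, by simp⟩
    apply SimpleGraph.Walk.isPath_of_length_eq_dist
    rw [SimpleGraph.Walk.length_cons, hp, G.dist_comm, ← hd, G.dist_comm]
  obtain ⟨p, hp, rfl⟩ := key y hy hdy
  obtain ⟨p', hp', rfl⟩ := key z hz hdz
  rw [(hG.existsUnique_path x o).unique hp hp']

open Classical in
/-- The neighbour of `x` on the way to the root `o`; it is `x` itself if `x = o`. -/
noncomputable def parent (G : SimpleGraph V) (o x : V) : V :=
  if h : ∃ y, G.Adj x y ∧ G.dist o x = G.dist o y + 1 then h.choose else x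

theorem parent_spec (hG : G.Connected) {o x : V} (hx : x ≠ o) :
    G.Adj x (parent G o x) ∧ G.dist o x = G.dist o (parent G o x) + 1 := by
  have h := exists_adj_dist_eq hG hx
  rw [parent, dif_pos h]
  exact h.choose_spec

theorem parent_eq (hG : G.IsTree) {o x y : V} (hy : G.Adj x y)
    (hd : G.dist o x = G.dist o y + 1) : parent G o x = y := by
  have hx : x ≠ o := by
    rintro rfl
    simp at hd
  have h := parent_spec hG.connected hx
  exact adj_dist_eq_unique hG h.1 hy h.2 hd

/-- `Λ` contains the root `o`, and with every vertex also the neighbours closer to `o`. -/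
def RootClosed (G : SimpleGraph V) (o : V) (Λ : Finset V) : Prop :=
  o ∈ Λ ∧ ∀ x ∈ Λ, ∀ y, G.Adj x y → G.dist o x = G.dist o y + 1 → y ∈ Λ

theorem RootClosed.parent_mem (hG : G.Connected) {o : V} {Λ : Finset V} (h : RootClosed G o Λ)
    {x : V} (hx : x ∈ Λ) (hxo : x ≠ o) : parent G o x ∈ Λ :=
  h.2 x hx _ (parent_spec hG hxo).1 (parent_spec hG hxo).2

theorem rootClosed_singleton (G : SimpleGraph V) (o : V) : RootClosed G o {o} := by
  refine ⟨by simp, ?_⟩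
  intro x hx y _ hd
  rw [Finset.mem_singleton] at hx
  subst hx
  simp at hd

theorem finite_dist_le [G.LocallyFinite] (hG : G.Connected) (o : V) (n : ℕ) :
    {x | G.dist o x ≤ n}.Finite := by
  induction n with
  | zero =>
    refine (Set.finite_singleton o).subset ?_
    intro x hx
    simp only [Set.mem_ofPred_eq, Nat.le_zero, hG.dist_eq_zero_iff] at hx
    exact hx.symm
  | succ n ih =>
    refine (ih.union (ih.biUnion fun x _ => (G.neighborSet x).toFinite)).subset ?_
    intro x hx
    by_cases h : G.dist o x ≤ n
    · exact Or.inl h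
    · have hxo : x ≠ o := by
        rintro rfl
        simp at h
      obtain ⟨y, hy, hd⟩ := exists_adj_dist_eq hG hxo
      refine Or.inr (Set.mem_biUnion (x := y) ?_ hy.symm)
      simp only [Set.mem_ofPred_eq] at hx h ⊢
      omega

/-- Every finite set of vertices lies in a finite set that is closed with respect to two given
roots. -/
theorem exists_rootClosed_superset [G.LocallyFinite] (hG : G.Connected) (o o' : V)
    (J : Finset V) : ∃ Λ : Finset V, J ⊆ Λ ∧ RootClosed G o Λ ∧ RootClosed G o' Λ := by
  have aux : ∀ n, {x | G.dist o x + G.dist o' x ≤ n}.Finite := fun n =>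
    (finite_dist_le hG o n).subset fun x hx => by
      simp only [Set.mem_ofPred_eq] at hx ⊢
      omega
  obtain ⟨n, hn⟩ : ∃ n, ∀ x ∈ J, G.dist o x + G.dist o' x ≤ n :=
    ⟨J.sup fun x => G.dist o x + G.dist o' x,
      fun x hx => Finset.le_sup (f := fun x => G.dist o x + G.dist o' x) hx⟩
  have step : ∀ {a x y : V}, G.Adj x y → G.dist a y ≤ G.dist a x + 1 := by
    intro a x y h
    have := hG.dist_triangle (u := a) (v := x) (w := y)
    rwa [SimpleGraph.dist_eq_one_iff_adj.2 h] at this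
  have hoo : G.dist o o' = G.dist o' o := G.dist_comm
  -- A step towards one root lowers that distance by one and raises the other by at most one, so
  -- sublevel sets of the sum of the distances are closed for both roots. Adding `G.dist o o'` to
  -- the level puts the roots inside.
  refine ⟨(aux (n + G.dist o o')).toFinset, ?_, ⟨?_, ?_⟩, ⟨?_, ?_⟩⟩
  · intro x hx
    have := hn x hx
    simp only [Set.Finite.mem_toFinset, Set.mem_ofPred_eq]
    omega
  · simp only [Set.Finite.mem_toFinset, Set.mem_ofPred_eq, SimpleGraph.dist_self]
    omega
  · intro x hx y hxy hd
    have := step (a := o') hxy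
    simp only [Set.Finite.mem_toFinset, Set.mem_ofPred_eq] at hx ⊢
    omega
  · simp only [Set.Finite.mem_toFinset, Set.mem_ofPred_eq, SimpleGraph.dist_self]
    omega
  · intro x hx y hxy hd
    have := step (a := o) hxy
    simp only [Set.Finite.mem_toFinset, Set.mem_ofPred_eq] at hx ⊢
    omega

theorem dist_iso (φ : G ≃g G) (x y : V) : G.dist (φ x) (φ y) = G.dist x y := by
  rw [SimpleGraph.dist_eq_sInf, SimpleGraph.dist_eq_sInf]
  congr 1
  ext n
  constructor
  · rintro ⟨p, rfl⟩
    exact ⟨(p.map φ.symm.toHom).copy (φ.symm_apply_apply x) (φ.symm_apply_apply y), by simp⟩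
  · rintro ⟨p, rfl⟩
    exact ⟨p.map φ.toHom, by simp⟩

theorem RootClosed.map (φ : G ≃g G) {o : V} {Λ : Finset V} (h : RootClosed G o Λ) :
    RootClosed G (φ o) (Λ.map φ.toEquiv.toEmbedding) := by
  constructor
  · exact Finset.mem_map_of_mem φ.toEquiv.toEmbedding h.1
  · intro x hx y hxy hd
    obtain ⟨x, hx', rfl⟩ := Finset.mem_map.1 hx
    obtain ⟨y, rfl⟩ := φ.surjective y
    change G.Adj (φ x) (φ y) at hxy
    change G.dist (φ o) (φ x) = _ at hd
    rw [dist_iso, dist_iso] at hd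
    exact Finset.mem_map_of_mem φ.toEquiv.toEmbedding (h.2 x hx' y (φ.map_adj_iff.1 hxy) hd)

open Classical in
/-- The edges of `G` with both endpoints in `Λ`. -/
noncomputable def innerEdges (G : SimpleGraph V) (Λ : Finset V) : Finset (Sym2 V) :=
  Λ.sym2.filter (· ∈ G.edgeSet)

theorem mk_mem_innerEdges {Λ : Finset V} {x y : V} :
    s(x, y) ∈ innerEdges G Λ ↔ (x ∈ Λ ∧ y ∈ Λ) ∧ G.Adj x y := by
  simp [innerEdges]

-- Each edge is charged to its endpoint farther from `o`; root-closedness keeps the parent edges of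
-- vertices of `Λ` inside `Λ`.
open Classical in
theorem prod_innerEdges {M : Type*} [CommMonoid M] (hG : G.IsTree) {o : V} {Λ : Finset V}
    (h : RootClosed G o Λ) (F : Sym2 V → M) :
    ∏ b ∈ innerEdges G Λ, F b = ∏ x ∈ Λ.erase o, F s(parent G o x, x) := by
  symm
  refine Finset.prod_bij (fun x _ => s(parent G o x, x)) ?_ ?_ ?_ fun _ _ => rfl
  · intro x hx
    rw [Finset.mem_erase] at hx
    exact mk_mem_innerEdges.2
      ⟨⟨h.parent_mem hG.connected hx.2 hx.1, hx.2⟩, (parent_spec hG.connected hx.1).1.symm⟩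
  · intro x hx y hy hxy
    rw [Finset.mem_erase] at hx hy
    have h1 := (parent_spec hG.connected hx.1).2
    have h2 := (parent_spec hG.connected hy.1).2
    rcases Sym2.eq_iff.1 hxy with ⟨-, h3⟩ | ⟨h3, h4⟩
    · exact h3
    · rw [h3] at h1
      rw [← h4] at h2
      omega
  · intro b
    induction b using Sym2.ind with
    | _ x y =>
      intro hb
      obtain ⟨⟨hx, hy⟩, hxy⟩ := mk_mem_innerEdges.1 hb
      rcases hG.dist_eq_dist_add_one_of_adj o hxy with hd | hd
      · refine ⟨x, Finset.mem_erase.2 ⟨?_, hx⟩, ?_⟩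
        · rintro rfl
          simp at hd
        · rw [parent_eq hG hxy hd, Sym2.eq_swap]
      · refine ⟨y, Finset.mem_erase.2 ⟨?_, hy⟩, ?_⟩
        · rintro rfl
          simp at hd
        · rw [parent_eq hG hxy.symm hd]

/-- The product of a symmetric function over the endpoints of an edge. -/
def symEdge {S M : Type*} (q : S → S → M) (hq : ∀ a b, q a b = q b a) (η : V → S)
    (b : Sym2 V) : M :=
  Sym2.lift ⟨fun x y => q (η x) (η y), fun _ _ => hq _ _⟩ b

@[simp] theorem symEdge_mk {S M : Type*} (q : S → S → M) (hq : ∀ a b, q a b = q b a)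
    (η : V → S) (x y : V) : symEdge q hq η s(x, y) = q (η x) (η y) := rfl

-- Regrouping by vertices: this moves the dressing of the edges onto the vertices, where it can meet
-- the vertex factors.
open Classical in
theorem prod_innerEdges_endpoints {S M : Type*} [CommMonoid M] (Λ : Finset V) (f : S → M)
    (η : V → S) :
    ∏ b ∈ innerEdges G Λ, symEdge (fun a b => f a * f b) (fun _ _ => mul_comm _ _) η b =
      ∏ x ∈ Λ, f (η x) ^ ((innerEdges G Λ).filter (x ∈ ·)).card := by
  have : ∀ b ∈ innerEdges G Λ,
      symEdge (fun a b => f a * f b) (fun _ _ => mul_comm _ _) η b =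
        ∏ x ∈ Λ.filter (· ∈ b), f (η x) := by
    intro b
    induction b using Sym2.ind with
    | _ x y =>
      intro hb
      obtain ⟨⟨hx, hy⟩, hxy⟩ := mk_mem_innerEdges.1 hb
      have : Λ.filter (· ∈ s(x, y)) = {x, y} := by
        ext z
        simp only [Finset.mem_filter, Sym2.mem_iff, Finset.mem_insert, Finset.mem_singleton]
        constructor
        · exact fun h => h.2
        · rintro (rfl | rfl)
          · exact ⟨hx, Or.inl rfl⟩
          · exact ⟨hy, Or.inr rfl⟩
      rw [this, Finset.prod_pair hxy.ne, symEdge_mk]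
  rw [Finset.prod_congr rfl this,
    Finset.prod_comm' (t' := Λ) (s' := fun x => (innerEdges G Λ).filter (x ∈ ·))]
  · simp
  · intro b x
    simp only [Finset.mem_filter]
    tauto

end Tree

/-! ### Tree-indexed Markov chains with root-free densities. -/

section Measure

open MeasureTheory ProbabilityTheory

variable {V : Type*} {k : ℕ}

/-- The configurations that agree with `η` on `Λ`. -/
def cyl (Λ : Finset V) (η : Config V k) : Set (Config V k) := {σ | ∀ x ∈ Λ, σ x = η x}

theorem measurableSet_cyl (Λ : Finset V) (η : Config V k) : MeasurableSet (cyl Λ η) := by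
  have : cyl Λ η = ⋂ x ∈ Λ, (fun σ : Config V k => σ x) ⁻¹' {η x} := by
    ext σ
    simp [cyl]
  rw [this]
  exact Finset.measurableSet_biInter _ fun x _ =>
    (measurable_pi_apply x) (measurableSet_singleton _)

-- The spin space is countable, so cylinders over `Λ` determine the marginal on `Λ` and hence on
-- every `J ⊆ Λ`; a measure is determined by its projective family of finite marginals.
open Classical in
theorem ext_of_cyl {μ ν : Measure (Config V k)} [IsFiniteMeasure μ]
    (h : ∀ J : Finset V, ∃ Λ, J ⊆ Λ ∧ ∀ η, μ (cyl Λ η) = ν (cyl Λ η)) : μ = ν := by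
  have hfull : ∀ Λ : Finset V, (∀ η, μ (cyl Λ η) = ν (cyl Λ η)) →
      μ.map Λ.restrict = ν.map Λ.restrict := by
    intro Λ hΛ
    apply Measure.ext_of_singleton
    intro a
    have : (Λ.restrict ⁻¹' {a} : Set (Config V k)) =
        cyl Λ (fun x => if hx : x ∈ Λ then a ⟨x, hx⟩ else 0) := by
      ext σ
      simp only [Set.mem_preimage, Set.mem_singleton_iff, cyl, Set.mem_ofPred_eq, funext_iff,
        Subtype.forall, Finset.restrict]
      exact forall₂_congr fun x hx => by rw [dif_pos hx]
    rw [Measure.map_apply (Finset.measurable_restrict Λ) (measurableSet_singleton a),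
      Measure.map_apply (Finset.measurable_restrict Λ) (measurableSet_singleton a), this, hΛ]
  have hall : ∀ J : Finset V, ν.map J.restrict = μ.map J.restrict := by
    intro J
    obtain ⟨Λ, hJ, hΛ⟩ := h J
    have hcomp : (J.restrict : Config V k → _) = Finset.restrict₂ hJ ∘ Λ.restrict := rfl
    rw [hcomp, ← Measure.map_map (Finset.measurable_restrict₂ hJ) (Finset.measurable_restrict Λ),
      ← Measure.map_map (Finset.measurable_restrict₂ hJ) (Finset.measurable_restrict Λ),
      hfull Λ hΛ]
  exact IsProjectiveLimit.unique (P := fun J => μ.map J.restrict) (fun _ => rfl) hall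

section MarkovChain

variable (G : SimpleGraph V) (o : V)

/-- The spin at the end of a line of descent of length `n`, when the vertex `x` reacts to the
spin `a` of its parent with the spin `ξ (x, a)`. -/
noncomputable def descend (ξ : V × Spin k → Spin k) : ℕ → V → Spin k
  | 0, x => ξ (x, 0)
  | n + 1, x => ξ (x, descend ξ n (parent G o x))

theorem measurable_descend (n : ℕ) (x : V) :
    Measurable fun ξ : V × Spin k → Spin k => descend G o ξ n x := by
  induction n generalizing x with
  | zero => exact measurable_pi_apply _
  | succ n ih =>
    have h : Measurable fun p : (V × Spin k → Spin k) × Spin k => p.1 (x, p.2) :=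
      measurable_from_prod_countable_left fun a => measurable_pi_apply (x, a)
    exact h.comp (measurable_id.prodMk (ih _))

/-- The configuration built from the reactions `ξ`, starting at the root. -/
noncomputable def config (ξ : V × Spin k → Spin k) (x : V) : Spin k := descend G o ξ (G.dist o x) x

theorem measurable_config : Measurable (config (k := k) G o) :=
  measurable_pi_lambda _ fun _ => measurable_descend G o _ _

variable {G o}

theorem config_root (ξ : V × Spin k → Spin k) : config G o ξ o = ξ (o, 0) := by
  simp [config, descend]

theorem config_of_ne (hG : G.Connected) (ξ : V × Spin k → Spin k) {x : V} (hx : x ≠ o) :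
    config G o ξ x = ξ (x, config G o ξ (parent G o x)) := by
  rw [config, (parent_spec hG hx).2, descend, config]

open Classical in
/-- The law of the reaction of `x` to the spin `a`. -/
noncomputable def reaction (o : V) (p : PMF (Spin k)) (P : Spin k → PMF (Spin k)) (i : V × Spin k) :
    PMF (Spin k) := if i.1 = o then p else P i.2

/-- The law of the tree-indexed Markov chain with initial law `p` at `o` and transitions `P`. -/
noncomputable def chainMeasure (G : SimpleGraph V) (o : V) (p : PMF (Spin k)) (P : Spin k → PMF (Spin k)) :
    Measure (Config V k) :=
  (Measure.infinitePi fun i => (reaction o p P i).toMeasure).map (config G o)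

instance (p : PMF (Spin k)) (P : Spin k → PMF (Spin k)) :
    IsProbabilityMeasure (chainMeasure G o p P) :=
  Measure.isProbabilityMeasure_map (measurable_config G o).aemeasurable

-- As long as the configuration follows `η`, the only reaction consulted at `x` is the one to `η
-- (parent G o x)`. The cylinder is therefore a box in distinct independent coordinates.
open Classical in
theorem chainMeasure_cyl (hG : G.Connected) (p : PMF (Spin k)) (P : Spin k → PMF (Spin k))
    {Λ : Finset V} (h : RootClosed G o Λ) (η : Config V k) :
    chainMeasure G o p P (cyl Λ η) =
      p (η o) * ∏ x ∈ Λ.erase o, P (η (parent G o x)) (η x) := by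
  -- The `0` at the root matches the dummy parent spin in `descend`.
  set a : V → V × Spin k := fun x => (x, if x = o then 0 else η (parent G o x)) with ha
  have hinj : Function.Injective a := fun x y hxy => congrArg Prod.fst hxy
  have hpre : config G o ⁻¹' cyl Λ η =
      Set.pi (Λ.map ⟨a, hinj⟩ : Finset (V × Spin k)) (fun i => {η i.1}) := by
    ext ξ
    simp only [Set.mem_preimage, cyl, Set.mem_ofPred_eq, Set.mem_pi, Finset.coe_map,
      Function.Embedding.coeFn_mk, Set.forall_mem_image, Finset.mem_coe, Set.mem_singleton_iff]
    constructor
    · intro hξ x hx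
      rw [← hξ x hx]
      by_cases hxo : x = o
      · subst hxo
        simp [ha, config_root]
      · simp only [ha, if_neg hxo]
        rw [config_of_ne hG ξ hxo, hξ _ (h.parent_mem hG hx hxo)]
    · intro hξ
      have key : ∀ n, ∀ x ∈ Λ, G.dist o x = n → config G o ξ x = η x := by
        intro n
        induction n with
        | zero =>
          intro x hx hd
          have hxo : x = o := (hG.dist_eq_zero_iff.1 hd).symm
          subst hxo
          have := hξ hx
          simpa [ha, config_root] using this
        | succ n ih =>
          intro x hx hd
          have hxo : x ≠ o := by
            rintro rfl
            simp at hd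
          have := hξ hx
          simp only [ha, if_neg hxo] at this
          rw [config_of_ne hG ξ hxo, ih _ (h.parent_mem hG hx hxo) ?_, this]
          have := (parent_spec hG hxo).2
          omega
      exact fun x hx => key _ x hx rfl
  rw [chainMeasure, Measure.map_apply (measurable_config G o) (measurableSet_cyl Λ η), hpre,
    Measure.infinitePi_pi _ fun _ _ => measurableSet_singleton _, Finset.prod_map,
    ← Finset.mul_prod_erase Λ _ h.1]
  congr 1
  · simp [ha, reaction, PMF.toMeasure_apply_singleton]
  · refine Finset.prod_congr rfl fun x hx => ?_
    have hxo : x ≠ o := (Finset.mem_erase.1 hx).1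
    simp [ha, reaction, hxo, PMF.toMeasure_apply_singleton]

end MarkovChain

/-- The law on the configurations in `Λ` with vertex factors `π` and edge factors `q`. -/
noncomputable def treeDensity (G : SimpleGraph V) (π : Spin k → ℝ≥0∞) (q : Spin k → Spin k → ℝ≥0∞)
    (hq : ∀ a b, q a b = q b a) (Λ : Finset V) (η : Config V k) : ℝ≥0∞ :=
  (∏ x ∈ Λ, π (η x)) * ∏ b ∈ innerEdges G Λ, symEdge q hq η b

/-- The summation hypotheses make `π` an initial law and `q a b * π b` a transition kernel; the
symmetry of `q` is detailed balance. The density then no longer sees the root, so chains from two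
roots agree on sets closed for both, and hence coincide. -/
theorem exists_measure_treeDensity (G : SimpleGraph V) [G.LocallyFinite] (hG : G.IsTree)
    (π : Spin k → ℝ≥0∞) (q : Spin k → Spin k → ℝ≥0∞) (hq : ∀ a b, q a b = q b a)
    (hπ : ∑' a, π a = 1) (hqπ : ∀ a, ∑' b, q a b * π b = 1) :
    ∃ μ : Measure (Config V k), IsProbabilityMeasure μ ∧
      ∀ o Λ, RootClosed G o Λ → ∀ η, μ (cyl Λ η) = treeDensity G π q hq Λ η := by
  classical
  let p : PMF (Spin k) := ⟨π, ENNReal.summable.hasSum_iff.2 hπ⟩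
  let P : Spin k → PMF (Spin k) := fun a =>
    ⟨fun b => q a b * π b, ENNReal.summable.hasSum_iff.2 (hqπ a)⟩
  have hcyl : ∀ o Λ, RootClosed G o Λ → ∀ η,
      chainMeasure G o p P (cyl Λ η) = treeDensity G π q hq Λ η := by
    intro o Λ h η
    rw [chainMeasure_cyl hG.connected p P h, treeDensity, prod_innerEdges hG h,
      ← Finset.mul_prod_erase Λ _ h.1, mul_assoc, ← Finset.prod_mul_distrib]
    congr 1
    exact Finset.prod_congr rfl fun x _ => mul_comm _ _
  obtain ⟨o⟩ := hG.connected.nonempty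
  have heq : ∀ o', chainMeasure G o p P = chainMeasure G o' p P := by
    intro o'
    refine ext_of_cyl fun J => ?_
    obtain ⟨Λ, hJ, h, h'⟩ := exists_rootClosed_superset hG.connected o o' J
    exact ⟨Λ, hJ, fun η => by rw [hcyl o Λ h, hcyl o' Λ h']⟩
  exact ⟨chainMeasure G o p P, inferInstance, fun o' Λ h η => by rw [heq o', hcyl o' Λ h]⟩

theorem treeDensity_map (G : SimpleGraph V) (π : Spin k → ℝ≥0∞) (q : Spin k → Spin k → ℝ≥0∞)
    (hq : ∀ a b, q a b = q b a) (Λ : Finset V) (η : Config V k) (φ : G ≃g G) :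
    treeDensity G π q hq (Λ.map φ.toEquiv.toEmbedding) η =
      treeDensity G π q hq Λ (fun x => η (φ x)) := by
  classical
  have hE : innerEdges G (Λ.map φ.toEquiv.toEmbedding) =
      (innerEdges G Λ).map φ.toEquiv.toEmbedding.sym2Map := by
    ext b
    induction b using Sym2.ind with
    | _ x y =>
      obtain ⟨x, rfl⟩ := φ.surjective x
      obtain ⟨y, rfl⟩ := φ.surjective y
      have h1 : s(φ x, φ y) = φ.toEquiv.toEmbedding.sym2Map s(x, y) := rfl
      rw [h1, Finset.mem_map', mk_mem_innerEdges, ← h1, mk_mem_innerEdges, φ.map_adj_iff]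
      have h2 : ∀ z, φ z ∈ Λ.map φ.toEquiv.toEmbedding ↔ z ∈ Λ := fun z =>
        Finset.mem_map' φ.toEquiv.toEmbedding
      rw [h2, h2]
  rw [treeDensity, treeDensity, hE, Finset.prod_map, Finset.prod_map]
  congr 1
  refine Finset.prod_congr rfl fun b _ => ?_
  induction b using Sym2.ind with
  | _ x y => rfl

/-- An automorphism carries a set closed for `o` to one closed for `φ o`; the cylinder formula holds
for both roots, with the same density. -/
theorem isAutomorphismInvariant_of_treeDensity (G : SimpleGraph V) [G.LocallyFinite]
    (hG : G.IsTree) {π : Spin k → ℝ≥0∞} {q : Spin k → Spin k → ℝ≥0∞}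
    {hq : ∀ a b, q a b = q b a} {μ : Measure (Config V k)} [IsProbabilityMeasure μ]
    (hμ : ∀ o Λ, RootClosed G o Λ → ∀ η, μ (cyl Λ η) = treeDensity G π q hq Λ η) :
    IsAutomorphismInvariant G μ := by
  intro φ
  have hmeas : Measurable fun (σ : Config V k) (x : V) => σ (φ x) :=
    measurable_pi_lambda _ fun x => measurable_pi_apply _
  symm
  refine ext_of_cyl fun J => ?_
  obtain ⟨o⟩ := hG.connected.nonempty
  obtain ⟨Λ, hJ, h, -⟩ := exists_rootClosed_superset hG.connected o o J
  refine ⟨Λ, hJ, fun η => ?_⟩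
  have hpre : (fun (σ : Config V k) (x : V) => σ (φ x)) ⁻¹' cyl Λ η =
      cyl (Λ.map φ.toEquiv.toEmbedding) (fun x => η (φ.symm x)) := by
    ext σ
    simp only [cyl, Set.mem_preimage, Set.mem_ofPred_eq, Finset.forall_mem_map]
    exact forall₂_congr fun x _ => by simp
  rw [Measure.map_apply hmeas (measurableSet_cyl Λ η), hpre, hμ _ _ (h.map φ), treeDensity_map,
    hμ _ _ h]
  simp

end Measure

/-! ### The DLR equations from the product form of the density. -/

section DLR

open MeasureTheory

variable {V : Type*} {k : ℕ} {G : SimpleGraph V} [G.LocallyFinite]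

theorem mk_mem_edgesMeeting {Λ : Finset V} {x y : V} :
    s(x, y) ∈ edgesMeeting G Λ ↔ G.Adj x y ∧ (x ∈ Λ ∨ y ∈ Λ) := by
  classical
  simp only [edgesMeeting, Finset.mem_biUnion, SimpleGraph.mem_incidenceFinset,
    SimpleGraph.incidenceSet, Set.mem_ofPred_eq, SimpleGraph.mem_edgeSet,
    Sym2.mem_iff]
  constructor
  · rintro ⟨z, hz, hxy, rfl | rfl⟩
    · exact ⟨hxy, Or.inl hz⟩
    · exact ⟨hxy, Or.inr hz⟩
  · rintro ⟨hxy, hx | hy⟩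
    · exact ⟨x, hx, hxy, Or.inl rfl⟩
    · exact ⟨y, hy, hxy, Or.inr rfl⟩

theorem glue_apply_of_mem {Λ : Finset V} (η : Λ → Spin k) (ω : Config V k) {x : V} (hx : x ∈ Λ) :
    glue Λ η ω x = η ⟨x, hx⟩ := dif_pos hx

theorem glue_apply_of_notMem {Λ : Finset V} (η : Λ → Spin k) (ω : Config V k) {x : V}
    (hx : x ∉ Λ) : glue Λ η ω x = ω x := dif_neg hx

theorem measurable_glue (Λ : Finset V) (η : Λ → Spin k) : Measurable (glue Λ η) := by
  refine measurable_pi_lambda _ fun x => ?_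
  by_cases hx : x ∈ Λ
  · simp only [glue_apply_of_mem _ _ hx, measurable_const]
  · simpa only [glue_apply_of_notMem _ _ hx] using measurable_pi_apply x

variable {Q : Spin k → ℝ} {hQ : Function.Even Q}

theorem edgeWeight_pos (hQpos : ∀ j, 0 < Q j) (ω : Config V k) (b : Sym2 V) :
    0 < edgeWeight Q hQ ω b := by
  induction b using Sym2.ind with
  | _ x y => exact hQpos _

theorem edgeWeight_congr {ω ω' : Config V k} {b : Sym2 V} (h : ∀ x ∈ b, ω x = ω' x) :
    edgeWeight Q hQ ω b = edgeWeight Q hQ ω' b := by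
  induction b using Sym2.ind with
  | _ x y =>
    change Q (ω x - ω y) = Q (ω' x - ω' y)
    rw [h x (Sym2.mem_mk_left x y), h y (Sym2.mem_mk_right x y)]

theorem measurable_edgeWeight (b : Sym2 V) :
    Measurable fun ω : Config V k => edgeWeight Q hQ ω b := by
  induction b using Sym2.ind with
  | _ x y =>
    exact (Measurable.of_discrete (f := Q)).comp ((measurable_pi_apply x).sub (measurable_pi_apply y))

theorem measurable_boltzmannWeight (Λ : Finset V) :
    Measurable fun ω : Config V k => boltzmannWeight G Q hQ Λ ω :=
  (Finset.measurable_prod _ fun b _ => measurable_edgeWeight b).ennreal_ofReal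

theorem measurable_partitionFunction (Λ : Finset V) :
    Measurable fun ω : Config V k => partitionFunction G Q hQ Λ ω :=
  Measurable.tsum fun η =>
    (measurable_boltzmannWeight Λ).comp (measurable_glue Λ η)

theorem gibbsKernel_apply (Λ : Finset V) (ω : Config V k) {S : Set (Config V k)}
    (hS : MeasurableSet S) :
    gibbsKernel G Q hQ Λ ω S = ∑' η : Λ → Spin k, (partitionFunction G Q hQ Λ ω)⁻¹ *
      boltzmannWeight G Q hQ Λ (glue Λ η ω) * S.indicator 1 (glue Λ η ω) := by
  rw [gibbsKernel, Measure.sum_apply _ hS]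
  refine tsum_congr fun η => ?_
  rw [Measure.smul_apply, Measure.dirac_apply' _ hS, smul_eq_mul]

theorem measurable_gibbsKernel (Λ : Finset V) :
    Measurable fun ω : Config V k => gibbsKernel G Q hQ Λ ω := by
  refine Measure.measurable_of_measurable_coe _ fun S hS => ?_
  simp only [gibbsKernel_apply Λ _ hS]
  refine Measurable.tsum fun η => ?_
  exact ((measurable_partitionFunction Λ).inv.mul
    ((measurable_boltzmannWeight Λ).comp (measurable_glue Λ η))).mul
    ((measurable_one.indicator hS).comp (measurable_glue Λ η))

theorem boltzmannWeight_ne_zero (hQpos : ∀ j, 0 < Q j) (Λ : Finset V) (ω : Config V k) :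
    boltzmannWeight G Q hQ Λ ω ≠ 0 := by
  rw [boltzmannWeight, Ne, ENNReal.ofReal_eq_zero, not_le]
  exact Finset.prod_pos fun b _ => edgeWeight_pos hQpos ω b

theorem boltzmannWeight_congr {Λ Δ : Finset V} (hΔ : edgesMeeting G Λ ⊆ innerEdges G Δ)
    {ω ω' : Config V k} (h : ∀ x ∈ Δ, ω x = ω' x) :
    boltzmannWeight G Q hQ Λ ω = boltzmannWeight G Q hQ Λ ω' := by
  rw [boltzmannWeight, boltzmannWeight]
  congr 1
  refine Finset.prod_congr rfl fun b hb => edgeWeight_congr ?_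
  replace hb := hΔ hb
  induction b using Sym2.ind with
  | _ x y =>
    have := (mk_mem_innerEdges.1 hb).1
    intro z hz
    rcases Sym2.mem_iff.1 hz with rfl | rfl
    · exact h _ this.1
    · exact h _ this.2

theorem partitionFunction_ne_zero (hQpos : ∀ j, 0 < Q j) (Λ : Finset V) (ω : Config V k) :
    partitionFunction G Q hQ Λ ω ≠ 0 := by
  rw [partitionFunction, Ne, ENNReal.tsum_eq_zero]
  exact fun h => boltzmannWeight_ne_zero hQpos Λ _ (h fun x => ω x)

theorem partitionFunction_congr {Λ Δ : Finset V} (hΔ : edgesMeeting G Λ ⊆ innerEdges G Δ)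
    {ω ω' : Config V k} (h : ∀ x ∈ Δ, x ∉ Λ → ω x = ω' x) :
    partitionFunction G Q hQ Λ ω = partitionFunction G Q hQ Λ ω' := by
  refine tsum_congr fun η => boltzmannWeight_congr hΔ fun x hx => ?_
  by_cases hxΛ : x ∈ Λ
  · rw [glue_apply_of_mem _ _ hxΛ, glue_apply_of_mem _ _ hxΛ]
  · rw [glue_apply_of_notMem _ _ hxΛ, glue_apply_of_notMem _ _ hxΛ, h x hx hxΛ]

open Classical in
/-- The part of the density on `Δ` that the spins in the interior `Λ` do not affect. -/
noncomputable def exteriorDensity (G : SimpleGraph V) [G.LocallyFinite] (Q : Spin k → ℝ)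
    (hQ : Function.Even Q) (π h : Spin k → ℝ≥0∞) (Λ Δ : Finset V) (η : Config V k) : ℝ≥0∞ :=
  (∏ b ∈ innerEdges G Δ \ edgesMeeting G Λ, ENNReal.ofReal (edgeWeight Q hQ η b)) *
    ∏ x ∈ Δ, π (η x) * h (η x) ^ ((innerEdges G Δ).filter (x ∈ ·)).card

/-- The edge factor `Q(a - b)` dressed with a factor `h` for each endpoint. -/
noncomputable def dressedWeight (Q : Spin k → ℝ) (h : Spin k → ℝ≥0∞) (a b : Spin k) : ℝ≥0∞ :=
  ENNReal.ofReal (Q (a - b)) * (h a * h b)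

theorem dressedWeight_comm (hQ : Function.Even Q) (h : Spin k → ℝ≥0∞) (a b : Spin k) :
    dressedWeight Q h a b = dressedWeight Q h b a := by
  rw [dressedWeight, dressedWeight, ← hQ, neg_sub, mul_comm (h a)]

theorem treeDensity_eq_mul_exteriorDensity (hQpos : ∀ j, 0 < Q j) (π h : Spin k → ℝ≥0∞)
    {Λ Δ : Finset V} (hΔ : edgesMeeting G Λ ⊆ innerEdges G Δ) (η : Config V k) :
    treeDensity G π (dressedWeight Q h) (dressedWeight_comm hQ h) Δ η =
      boltzmannWeight G Q hQ Λ η * exteriorDensity G Q hQ π h Λ Δ η := by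
  classical
  have h1 : ∀ b, symEdge (dressedWeight Q h) (dressedWeight_comm hQ h) η b =
      ENNReal.ofReal (edgeWeight Q hQ η b) *
        symEdge (fun a b => h a * h b) (fun _ _ => mul_comm _ _) η b := by
    intro b
    induction b using Sym2.ind with
    | _ x y => rfl
  rw [treeDensity, Finset.prod_congr rfl fun b _ => h1 b, Finset.prod_mul_distrib,
    prod_innerEdges_endpoints, exteriorDensity, Finset.prod_mul_distrib, boltzmannWeight,
    ENNReal.ofReal_prod_of_nonneg fun b _ => (edgeWeight_pos hQpos η b).le,
    ← Finset.prod_sdiff hΔ]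
  ring

theorem exteriorDensity_ne_zero (hQpos : ∀ j, 0 < Q j) {π h : Spin k → ℝ≥0∞}
    (hπ : ∀ a, π a ≠ 0) (hh : ∀ a, h a ≠ 0) (Λ Δ : Finset V) (η : Config V k) :
    exteriorDensity G Q hQ π h Λ Δ η ≠ 0 := by
  classical
  refine mul_ne_zero (Finset.prod_ne_zero_iff.2 fun b _ => ?_)
    (Finset.prod_ne_zero_iff.2 fun x _ => mul_ne_zero (hπ _) (pow_ne_zero _ (hh _)))
  rw [Ne, ENNReal.ofReal_eq_zero, not_le]
  exact edgeWeight_pos hQpos η b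

/-- The cancellation behind the DLR equations: a vertex of `Λ` has all its `n` edges inside `Δ`, so
it contributes `π a * h a ^ n = c` whatever its spin. The remaining edges do not touch `Λ`. -/
theorem exteriorDensity_congr {π h : Spin k → ℝ≥0∞} {n : ℕ} {c : ℝ≥0∞}
    (hreg : G.IsRegularOfDegree n) (hc : ∀ a, π a * h a ^ n = c) {Λ Δ : Finset V}
    (hΔ : edgesMeeting G Λ ⊆ innerEdges G Δ) {η η' : Config V k}
    (hη : ∀ x ∉ Λ, η x = η' x) :
    exteriorDensity G Q hQ π h Λ Δ η = exteriorDensity G Q hQ π h Λ Δ η' := by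
  classical
  rw [exteriorDensity, exteriorDensity]
  congr 1
  · refine Finset.prod_congr rfl fun b hb => ?_
    congr 1
    refine edgeWeight_congr fun x hx => hη x fun hxΛ => ?_
    rw [Finset.mem_sdiff] at hb
    refine hb.2 ?_
    obtain ⟨y, rfl⟩ := hx
    exact mk_mem_edgesMeeting.2 ⟨(mk_mem_innerEdges.1 hb.1).2, Or.inl hxΛ⟩
  · refine Finset.prod_congr rfl fun x _ => ?_
    by_cases hx : x ∈ Λ
    · have : ((innerEdges G Δ).filter (x ∈ ·)).card = n := by
        rw [← hreg x, ← G.card_incidenceFinset_eq_degree]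
        congr 1
        ext b
        rw [Finset.mem_filter, SimpleGraph.mem_incidenceFinset]
        constructor
        · rintro ⟨hb, y, rfl⟩
          exact ⟨(mk_mem_innerEdges.1 hb).2, Sym2.mem_mk_left x y⟩
        · rintro ⟨hb, y, rfl⟩
          exact ⟨hΔ (mk_mem_edgesMeeting.2 ⟨hb, Or.inl hx⟩), Sym2.mem_mk_left x y⟩
      rw [this, hc, hc]
    · rw [hη x hx]

open Classical in
theorem measure_cyl_sdiff {Λ Δ : Finset V} (hΛ : Λ ⊆ Δ) (μ : Measure (Config V k))
    (η : Config V k) :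
    μ (cyl (Δ \ Λ) η) = ∑' ξ : Λ → Spin k, μ (cyl Δ (glue Λ ξ η)) := by
  rw [← measure_iUnion]
  · congr 1
    ext σ
    simp only [cyl, Set.mem_ofPred_eq, Set.mem_iUnion, Finset.mem_sdiff]
    constructor
    · intro h
      refine ⟨fun x => σ x, fun x hx => ?_⟩
      by_cases hxΛ : x ∈ Λ
      · rw [glue_apply_of_mem _ _ hxΛ]
      · rw [glue_apply_of_notMem _ _ hxΛ, h x ⟨hx, hxΛ⟩]
    · rintro ⟨ξ, h⟩ x ⟨hx, hxΛ⟩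
      rw [h x hx, glue_apply_of_notMem _ _ hxΛ]
  · intro ξ ξ' hne
    refine Set.disjoint_left.2 fun σ h h' => hne ?_
    ext1 x
    have h1 := h x (hΛ x.2)
    have h2 := h' x (hΛ x.2)
    rw [glue_apply_of_mem _ _ x.2] at h1 h2
    rw [← h1, ← h2]
  · exact fun ξ => measurableSet_cyl _ _

theorem gibbsKernel_cyl {Λ Δ : Finset V} (hΛ : Λ ⊆ Δ)
    (hΔ : edgesMeeting G Λ ⊆ innerEdges G Δ) (η ω : Config V k) [DecidableEq V] :
    gibbsKernel G Q hQ Λ ω (cyl Δ η) = (cyl (Δ \ Λ) η).indicator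
      (fun _ => (partitionFunction G Q hQ Λ η)⁻¹ * boltzmannWeight G Q hQ Λ η) ω := by
  have hmem : ∀ ξ : Λ → Spin k, glue Λ ξ ω ∈ cyl Δ η ↔
      ξ = (fun x : Λ => η x) ∧ ω ∈ cyl (Δ \ Λ) η := by
    intro ξ
    constructor
    · intro h
      refine ⟨funext fun x => ?_, fun x hx => ?_⟩
      · rw [← h x (hΛ x.2), glue_apply_of_mem _ _ x.2]
      · rw [Finset.mem_sdiff] at hx
        rw [← h x hx.1, glue_apply_of_notMem _ _ hx.2]
    · rintro ⟨rfl, h⟩ x hx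
      by_cases hxΛ : x ∈ Λ
      · rw [glue_apply_of_mem _ _ hxΛ]
      · rw [glue_apply_of_notMem _ _ hxΛ, h x (Finset.mem_sdiff.2 ⟨hx, hxΛ⟩)]
  -- Only the restriction of `η` to `Λ` can be glued into the cylinder.
  rw [gibbsKernel_apply Λ ω (measurableSet_cyl Δ η), tsum_eq_single (fun x : Λ => η x)]
  · by_cases hω : ω ∈ cyl (Δ \ Λ) η
    · have hg := (hmem _).2 ⟨rfl, hω⟩
      rw [Set.indicator_of_mem hg, Set.indicator_of_mem hω, Pi.one_apply, mul_one,
        boltzmannWeight_congr hΔ hg,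
        partitionFunction_congr hΔ fun x hx hxΛ => hω x (Finset.mem_sdiff.2 ⟨hx, hxΛ⟩)]
    · rw [Set.indicator_of_notMem hω, Set.indicator_of_notMem fun h => hω ((hmem _).1 h).2,
        mul_zero]
  · intro ξ hξ
    rw [Set.indicator_of_notMem fun h => hξ ((hmem _).1 h).1, mul_zero]

/-- On a large `Δ` the density is the Boltzmann weight times a factor blind to the spins in `Λ`.
Summing these spins out replaces the weight by the partition function, so the conditional law in `Λ`
is the Gibbs kernel. -/
theorem isGibbsMeasure_of_treeDensity (hG : G.IsTree) {n : ℕ} (hreg : G.IsRegularOfDegree n)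
    (hQpos : ∀ j, 0 < Q j) {π h : Spin k → ℝ≥0∞} {c : ℝ≥0∞} (hπ : ∀ a, π a ≠ 0)
    (hh : ∀ a, h a ≠ 0) (hc : ∀ a, π a * h a ^ n = c) {μ : Measure (Config V k)}
    [IsProbabilityMeasure μ]
    (hμ : ∀ o Λ, RootClosed G o Λ → ∀ η,
      μ (cyl Λ η) = treeDensity G π (dressedWeight Q h) (dressedWeight_comm hQ h) Λ η) :
    IsGibbsMeasure G Q hQ μ := by
  classical
  obtain ⟨o⟩ := hG.connected.nonempty
  have hlarge : ∀ Λ J : Finset V, ∃ Δ, J ⊆ Δ ∧ Λ ⊆ Δ ∧ RootClosed G o Δ ∧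
      edgesMeeting G Λ ⊆ innerEdges G Δ := by
    intro Λ J
    obtain ⟨Δ, hJ, h, -⟩ := exists_rootClosed_superset hG.connected o o
      (J ∪ Λ ∪ Λ.biUnion fun x => G.neighborFinset x)
    have hΛ : Λ ⊆ Δ := fun x hx => hJ (by simp [hx])
    have hN : ∀ x ∈ Λ, ∀ y, G.Adj x y → y ∈ Δ := fun x hx y hxy => hJ <| by
      simp only [Finset.mem_union, Finset.mem_biUnion, SimpleGraph.mem_neighborFinset]
      exact Or.inr ⟨x, hx, hxy⟩
    refine ⟨Δ, fun x hx => hJ (by simp [hx]), hΛ, h, fun b => ?_⟩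
    induction b using Sym2.ind with
    | _ x y =>
      intro hb
      obtain ⟨hxy, hx | hy⟩ := mk_mem_edgesMeeting.1 hb
      · exact mk_mem_innerEdges.2 ⟨⟨hΛ hx, hN x hx y hxy⟩, hxy⟩
      · exact mk_mem_innerEdges.2 ⟨⟨hN y hy x hxy.symm, hΛ hy⟩, hxy⟩
  have hsdiff : ∀ Λ Δ : Finset V, Λ ⊆ Δ → RootClosed G o Δ →
      edgesMeeting G Λ ⊆ innerEdges G Δ → ∀ η, μ (cyl (Δ \ Λ) η) =
        partitionFunction G Q hQ Λ η * exteriorDensity G Q hQ π h Λ Δ η := by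
    intro Λ Δ hΛ hcl hΔ η
    rw [measure_cyl_sdiff hΛ, partitionFunction, ← ENNReal.tsum_mul_right]
    refine tsum_congr fun ξ => ?_
    rw [hμ o Δ hcl, treeDensity_eq_mul_exteriorDensity hQpos π h hΔ,
      exteriorDensity_congr hreg hc hΔ fun x hx => glue_apply_of_notMem ξ η hx]
  -- An infinite partition function, times the nonzero exterior factor, would give a cylinder
  -- infinite mass.
  have htop : ∀ Λ ω, partitionFunction G Q hQ Λ ω ≠ ∞ := by
    intro Λ ω htop
    obtain ⟨Δ, -, hΛ, hcl, hΔ⟩ := hlarge Λ ∅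
    have := hsdiff Λ Δ hΛ hcl hΔ ω
    rw [htop, ENNReal.top_mul (exteriorDensity_ne_zero hQpos hπ hh Λ Δ ω)] at this
    exact measure_ne_top μ _ this
  refine ⟨partitionFunction_ne_zero hQpos, htop, inferInstance, fun Λ S hS => ?_⟩
  have hmeas := (measurable_gibbsKernel (G := G) (Q := Q) (hQ := hQ) Λ).aemeasurable (μ := μ)
  rw [← Measure.bind_apply hS hmeas]
  congr 1
  symm
  refine ext_of_cyl fun J => ?_
  obtain ⟨Δ, hJ, hΛ, hcl, hΔ⟩ := hlarge Λ J
  refine ⟨Δ, hJ, fun η => ?_⟩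
  rw [Measure.bind_apply (measurableSet_cyl Δ η) hmeas]
  simp only [gibbsKernel_cyl hΛ hΔ]
  rw [lintegral_indicator_const (measurableSet_cyl _ _), hsdiff Λ Δ hΛ hcl hΔ,
    hμ o Δ hcl, treeDensity_eq_mul_exteriorDensity hQpos π h hΔ]
  set Z := partitionFunction G Q hQ Λ η
  calc _ = Z⁻¹ * Z * (boltzmannWeight G Q hQ Λ η * exteriorDensity G Q hQ π h Λ Δ η) := by
        rw [ENNReal.inv_mul_cancel (partitionFunction_ne_zero hQpos Λ η) (htop Λ η), one_mul]
    _ = _ := by ring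

end DLR

/-! ### From boundary laws to Gibbs measures. -/

section BoundaryLaw

open MeasureTheory

variable {V : Type*} {k : ℕ}

/-- With `π = u ^ (d + 1) / Z` and `h = c / u`, the power of `u` cancels in `π * h ^ (d + 1)`, while
the boundary law equation makes the transition kernel stochastic. -/
theorem exists_isGibbsMeasure_of_boundaryLaw (G : SimpleGraph V) [G.LocallyFinite]
    (hG : G.IsTree) {d : ℕ} (hreg : G.IsRegularOfDegree (d + 1)) {Q : Spin k → ℝ}
    (hQ : Function.Even Q) (hQpos : ∀ j, 0 < Q j) {u : Spin k → ℝ} (hu : ∀ j, 0 < u j)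
    {N Z : ℝ} (hN : ∀ i, HasSum (fun j => Q (i - j) * u j ^ d) (N * u i))
    (hZ : HasSum (fun j => u j ^ (d + 1)) Z) :
    ∃ μ : Measure (Config V k), IsGibbsMeasure G Q hQ μ ∧ IsAutomorphismInvariant G μ ∧
      ∀ x a, μ.real {σ | σ x = a} = u a ^ (d + 1) / Z := by
  have hZ0 : 0 < Z := (pow_pos (hu 0) _).trans_le
    (le_hasSum hZ 0 fun j _ => (pow_pos (hu j) _).le)
  have hN0 : 0 < N := by
    have h := (mul_pos (hQpos (0 - 0)) (pow_pos (hu 0) d)).trans_le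
      (le_hasSum (hN 0) 0 fun j _ => (mul_pos (hQpos _) (pow_pos (hu j) _)).le)
    exact pos_of_mul_pos_left h (hu 0).le
  -- Each edge carries two factors `h`, so `c * c = Z / N` trades the normalization `Z` of `π` for
  -- the eigenvalue `N`.
  set c : ℝ := √(Z / N) with hc
  have hc0 : 0 < c := Real.sqrt_pos.2 (div_pos hZ0 hN0)
  have hc2 : c * c = Z / N := Real.mul_self_sqrt (div_pos hZ0 hN0).le
  let π : Spin k → ℝ≥0∞ := fun a => ENNReal.ofReal (u a ^ (d + 1) / Z)
  let h : Spin k → ℝ≥0∞ := fun a => ENNReal.ofReal (c / u a)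
  have hπpos : ∀ a, 0 < u a ^ (d + 1) / Z := fun a => div_pos (pow_pos (hu a) _) hZ0
  have hhpos : ∀ a, 0 < c / u a := fun a => div_pos hc0 (hu a)
  have hπ1 : ∑' a, π a = 1 := by
    have hs : HasSum (fun a => u a ^ (d + 1) / Z) 1 := by
      simpa [hZ0.ne'] using hZ.div_const Z
    rw [← ENNReal.ofReal_tsum_of_nonneg (fun a => (hπpos a).le) hs.summable, hs.tsum_eq,
      ENNReal.ofReal_one]
  have hqπ : ∀ a, ∑' b, dressedWeight Q h a b * π b = 1 := by
    intro a
    have hs : HasSum (fun b => Q (a - b) * u b ^ d / (N * u a)) 1 := by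
      have := (hN a).div_const (N * u a)
      rwa [div_self (mul_pos hN0 (hu a)).ne'] at this
    rw [← ENNReal.ofReal_one, ← hs.tsum_eq, ENNReal.ofReal_tsum_of_nonneg
      (fun b => (div_pos (mul_pos (hQpos _) (pow_pos (hu b) _)) (mul_pos hN0 (hu a))).le)
      hs.summable]
    refine tsum_congr fun b => ?_
    simp only [dressedWeight, π, h]
    rw [← ENNReal.ofReal_mul (hhpos a).le, ← ENNReal.ofReal_mul (hQpos _).le,
      ← ENNReal.ofReal_mul (mul_pos (hQpos _) (mul_pos (hhpos a) (hhpos b))).le]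
    congr 1
    have ha := (hu a).ne'
    have hb := (hu b).ne'
    calc Q (a - b) * (c / u a * (c / u b)) * (u b ^ (d + 1) / Z)
        = Q (a - b) * (c * c) * u b ^ d / (u a * Z) := by
            field_simp
            ring
      _ = Q (a - b) * u b ^ d / (N * u a) := by
        rw [hc2]
        field_simp
  have hconst : ∀ a, π a * h a ^ (d + 1) = ENNReal.ofReal (c ^ (d + 1) / Z) := by
    intro a
    simp only [π, h]
    rw [← ENNReal.ofReal_pow (hhpos a).le, ← ENNReal.ofReal_mul (hπpos a).le]
    congr 1
    rw [div_mul_eq_mul_div, ← mul_pow, mul_div_cancel₀ _ (hu a).ne']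
  obtain ⟨μ, hprob, hμ⟩ := exists_measure_treeDensity G hG π (dressedWeight Q h)
    (dressedWeight_comm hQ h) hπ1 hqπ
  refine ⟨μ, isGibbsMeasure_of_treeDensity hG hreg hQpos
    (fun a => (ENNReal.ofReal_pos.2 (hπpos a)).ne')
    (fun a => (ENNReal.ofReal_pos.2 (hhpos a)).ne') hconst hμ,
    isAutomorphismInvariant_of_treeDensity G hG hμ, fun x a => ?_⟩
  have hset : {σ : Config V k | σ x = a} = cyl {x} (fun _ => a) := by
    ext σ
    simp [cyl]
  have hE : innerEdges G {x} = ∅ := by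
    ext b
    induction b using Sym2.ind with
    | _ y z =>
      simp only [mk_mem_innerEdges, Finset.mem_singleton, Finset.notMem_empty, iff_false]
      rintro ⟨⟨rfl, rfl⟩, h⟩
      exact h.ne rfl
  rw [hset, measureReal_def, hμ x _ (rootClosed_singleton G x), treeDensity, hE]
  simp [π, (hπpos a).le]

end BoundaryLaw

/-! ### A fixed-point principle and convolution inequalities. -/

section FixedPoint

open Filter Topology

variable {S : Type*}

/-- A map that halves uniform distances on a pointwise closed set of functions has a fixed
point there. -/
theorem exists_fixedPoint_of_half_contracting {p : (S → ℝ) → Prop} {T : (S → ℝ) → S → ℝ}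
    (hclosed : ∀ (w : ℕ → S → ℝ) (w' : S → ℝ), (∀ m, p (w m)) →
      (∀ i, Tendsto (fun m => w m i) atTop (𝓝 (w' i))) → p w')
    (hmaps : ∀ w, p w → p (T w))
    (hcontr : ∀ w w' ε, p w → p w' → (∀ i, |w i - w' i| ≤ ε) → ∀ i, |T w i - T w' i| ≤ ε / 2)
    {w₀ : S → ℝ} (hw₀ : p w₀) {M : ℝ} (hM : ∀ i, |w₀ i - T w₀ i| ≤ M) :
    ∃ w, p w ∧ T w = w := by
  let a : ℕ → S → ℝ := fun m => T^[m] w₀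
  have hsucc : ∀ m, a (m + 1) = T (a m) := fun m => Function.iterate_succ_apply' T m w₀
  have hp : ∀ m, p (a m) := by
    intro m
    induction m with
    | zero => exact hw₀
    | succ m ih => rw [hsucc]; exact hmaps _ ih
  have hdist : ∀ m i, |a m i - a (m + 1) i| ≤ M * (1 / 2) ^ m := by
    intro m
    induction m with
    | zero => simpa [a] using hM
    | succ m ih =>
      intro i
      rw [hsucc (m + 1), hsucc m]
      have := hcontr _ _ _ (hp m) (hp (m + 1)) ih i
      rw [hsucc m] at this
      rw [pow_succ]
      linarith
  have hlim : ∀ i, ∃ l, Tendsto (fun m => a m i) atTop (𝓝 l) := fun i =>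
    cauchySeq_tendsto_of_complete
      (cauchySeq_of_le_geometric (1 / 2) M (by norm_num) fun m => hdist m i)
  choose w hw using hlim
  have hpw : p w := hclosed a w hp hw
  refine ⟨w, hpw, funext fun i => ?_⟩
  have hconv : ∀ m i, |a m i - w i| ≤ M * (1 / 2) ^ m / (1 - 1 / 2) := fun m i =>
    dist_le_of_le_geometric_of_tendsto (1 / 2) M (by norm_num) (fun m => hdist m i) (hw i) m
  have hT : Tendsto (fun m => a (m + 1) i) atTop (𝓝 (T w i)) := by
    rw [tendsto_iff_dist_tendsto_zero]
    refine squeeze_zero (g := fun m => M * (1 / 2) ^ m) (fun _ => dist_nonneg) (fun m => ?_) ?_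
    · rw [hsucc, Real.dist_eq]
      have := hcontr _ _ _ (hp m) hpw (hconv m) i
      refine this.trans_eq ?_
      ring
    · simpa using (tendsto_pow_atTop_nhds_zero_of_lt_one (r := (1 / 2 : ℝ)) (by norm_num)
        (by norm_num)).const_mul M
  exact tendsto_nhds_unique hT ((tendsto_add_atTop_iff_nat 1).2 (hw i))

/-- Jensen's inequality for the weights `a j / ∑ a`; the case of total weight zero is separate. -/
theorem pow_sum_mul_le (t : Finset S) {f a : S → ℝ} (hf : ∀ j, 0 ≤ f j) (ha : ∀ j, 0 ≤ a j)
    {δ : ℝ} (hδ : ∑ j ∈ t, a j ≤ δ) (n : ℕ) :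
    (∑ j ∈ t, f j * a j) ^ (n + 1) ≤ δ ^ n * ∑ j ∈ t, f j ^ (n + 1) * a j := by
  have hA : 0 ≤ ∑ j ∈ t, a j := Finset.sum_nonneg fun j _ => ha j
  rcases hA.eq_or_lt with hA0 | hA0
  · have h0 : ∀ j ∈ t, a j = 0 := (Finset.sum_eq_zero_iff_of_nonneg fun j _ => ha j).1 hA0.symm
    rw [Finset.sum_eq_zero fun j hj => by rw [h0 j hj, mul_zero],
      Finset.sum_eq_zero fun j hj => by rw [h0 j hj, mul_zero]]
    simp
  set B := ∑ j ∈ t, a j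
  have hJ := Real.pow_arith_mean_le_arith_mean_pow t (fun j => a j / B) f
    (fun j _ => div_nonneg (ha j) hA) (by rw [← Finset.sum_div, div_self hA0.ne'])
    (fun j _ => hf j) (n + 1)
  have h1 : ∀ g : S → ℝ, ∑ j ∈ t, a j / B * g j = (∑ j ∈ t, g j * a j) / B := fun g => by
    rw [Finset.sum_div]
    exact Finset.sum_congr rfl fun j _ => by ring
  rw [h1, h1, div_pow, div_le_div_iff₀ (pow_pos hA0 _) hA0] at hJ
  have hJ' : (∑ j ∈ t, f j * a j) ^ (n + 1) ≤ B ^ n * ∑ j ∈ t, f j ^ (n + 1) * a j := by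
    refine le_of_mul_le_mul_right (hJ.trans_eq ?_) hA0
    ring
  refine hJ'.trans (mul_le_mul_of_nonneg_right (pow_le_pow_left₀ hA hδ n) ?_)
  exact Finset.sum_nonneg fun j _ => mul_nonneg (pow_nonneg (hf j) _) (ha j)

theorem summable_mul_of_le_one {f a : S → ℝ} (hf : ∀ j, 0 ≤ f j) (hf1 : ∀ j, f j ≤ 1)
    (ha : ∀ j, 0 ≤ a j) (has : Summable a) : Summable fun j => f j * a j :=
  has.of_nonneg_of_le (fun j => mul_nonneg (hf j) (ha j))
    fun j => mul_le_of_le_one_left (ha j) (hf1 j)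

/-- A bound for the `ℓ^n` norm of the convolution of a function in `ℓ^n` and one in `ℓ^1`. -/
theorem sum_pow_convolution_le [AddCommGroup S] {Q a : S → ℝ} (hQ : ∀ j, 0 ≤ Q j)
    (hQ1 : ∀ j, Q j ≤ 1) (ha : ∀ j, 0 ≤ a j) (has : Summable a) {δ B : ℝ}
    (hδ : ∑' j, a j ≤ δ) (hB : 0 ≤ B) {n : ℕ} (hQB : ∀ s : Finset S, ∑ i ∈ s, Q i ^ (n + 1) ≤ B)
    (s : Finset S) :
    ∑ i ∈ s, (∑' j, Q (i - j) * a j) ^ (n + 1) ≤ δ ^ (n + 1) * B := by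
  have hδ0 : 0 ≤ δ := (tsum_nonneg ha).trans hδ
  have hs1 : ∀ i, Summable fun j => Q (i - j) * a j := fun i =>
    summable_mul_of_le_one (fun j => hQ _) (fun j => hQ1 _) ha has
  have hs2 : ∀ i, Summable fun j => Q (i - j) ^ (n + 1) * a j := fun i =>
    summable_mul_of_le_one (fun j => pow_nonneg (hQ _) _)
      (fun j => pow_le_one₀ (hQ _) (hQ1 _)) ha has
  have hpoint : ∀ i, (∑' j, Q (i - j) * a j) ^ (n + 1) ≤
      δ ^ n * ∑' j, Q (i - j) ^ (n + 1) * a j := by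
    intro i
    refine le_of_tendsto ((hs1 i).hasSum.pow (n + 1)) (Eventually.of_forall fun t => ?_)
    refine (pow_sum_mul_le t (fun j => hQ (i - j)) ha
      ((has.sum_le_tsum t fun j _ => ha j).trans hδ) n).trans ?_
    exact mul_le_mul_of_nonneg_left
      ((hs2 i).sum_le_tsum t fun j _ => mul_nonneg (pow_nonneg (hQ _) _) (ha j))
      (pow_nonneg hδ0 n)
  have hcol : ∀ j, ∑ i ∈ s, Q (i - j) ^ (n + 1) ≤ B := by
    intro j
    have := hQB (s.map (Equiv.subRight j).toEmbedding)
    rwa [Finset.sum_map] at this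
  calc ∑ i ∈ s, (∑' j, Q (i - j) * a j) ^ (n + 1)
      ≤ ∑ i ∈ s, δ ^ n * ∑' j, Q (i - j) ^ (n + 1) * a j := Finset.sum_le_sum fun i _ => hpoint i
    _ = δ ^ n * ∑' j, ∑ i ∈ s, Q (i - j) ^ (n + 1) * a j := by
      rw [← Finset.mul_sum, Summable.tsum_finsetSum fun i _ => hs2 i]
    _ ≤ δ ^ n * ∑' j, B * a j := by
      refine mul_le_mul_of_nonneg_left ?_ (pow_nonneg hδ0 n)
      refine Summable.tsum_le_tsum (fun j => ?_) (summable_sum fun i _ => hs2 i) (has.mul_left B)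
      rw [← Finset.sum_mul]
      exact mul_le_mul_of_nonneg_right (hcol j) (ha j)
    _ = δ ^ n * (B * ∑' j, a j) := by rw [tsum_mul_left]
    _ ≤ δ ^ n * (B * δ) := by gcongr
    _ = δ ^ (n + 1) * B := by ring

/-- If `n b ≤ a`, the sum costs a factor `(1 + 1 / n) ^ n ≤ e ≤ 3`; otherwise `a` is absorbed into
`b`. The constant at `a ^ n` stays bounded in `n`, unlike the `2 ^ (n - 1)` of convexity. -/
theorem add_pow_le_three_mul {a b : ℝ} (ha : 0 ≤ a) (hb : 0 ≤ b) {n : ℕ} (hn : n ≠ 0) :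
    (a + b) ^ n ≤ 3 * a ^ n + ((n + 1) * b) ^ n := by
  have hn0 : (0 : ℝ) < n := by positivity
  rcases le_total (n * b) a with h | h
  · have h1 : a + b ≤ (1 / n + 1) * a := by
      have : b ≤ 1 / n * a := by
        rw [one_div, inv_mul_eq_div, le_div_iff₀ hn0]
        linarith
      linarith
    have h2 : (1 / (n : ℝ) + 1) ^ n ≤ 3 := by
      calc (1 / (n : ℝ) + 1) ^ n ≤ Real.exp (1 / n) ^ n := by
            gcongr
            exact Real.add_one_le_exp _
        _ = Real.exp 1 := by rw [← Real.exp_nat_mul, mul_one_div_cancel hn0.ne']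
        _ ≤ 3 := by linarith [Real.exp_one_lt_d9]
    calc (a + b) ^ n ≤ ((1 / n + 1) * a) ^ n := by gcongr
      _ = (1 / (n : ℝ) + 1) ^ n * a ^ n := mul_pow _ _ _
      _ ≤ 3 * a ^ n := by gcongr
      _ ≤ _ := le_add_of_nonneg_right (by positivity)
  · calc (a + b) ^ n ≤ ((n + 1) * b) ^ n := by
          gcongr
          linarith
      _ ≤ _ := le_add_of_nonneg_left (by positivity)

end FixedPoint

/-! ### Existence of a boundary law concentrated at the origin. -/

section BoundaryLawExistence

open Filter Topology

variable {S : Type*}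

/-- Nonnegative functions that vanish at the origin and whose `n`-th powers sum to at most `δ`. -/
structure SmallOffOrigin [AddCommGroup S] (n : ℕ) (δ : ℝ) (w : S → ℝ) : Prop where
  zero : w 0 = 0
  nonneg : ∀ i, 0 ≤ w i
  sum_le : ∀ s : Finset S, ∑ i ∈ s, w i ^ n ≤ δ

namespace SmallOffOrigin

variable [AddCommGroup S] {n : ℕ} {δ : ℝ} {w : S → ℝ}

theorem lt_one (hw : SmallOffOrigin n δ w) (hδ : δ < 1) (i : S) : w i < 1 := by
  by_contra! h
  have h1 := hw.sum_le {i}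
  rw [Finset.sum_singleton] at h1
  linarith [one_le_pow₀ h (n := n)]

theorem summable (hw : SmallOffOrigin n δ w) : Summable fun i => w i ^ n :=
  summable_of_sum_le (fun i => pow_nonneg (hw.nonneg i) n) hw.sum_le

theorem tsum_le (hw : SmallOffOrigin n δ w) : ∑' i, w i ^ n ≤ δ :=
  hw.summable.tsum_le_of_sum_le hw.sum_le

theorem pow_le_pow (hw : SmallOffOrigin n δ w) (hδ : δ < 1) {m : ℕ} (hm : n ≤ m) (i : S) :
    w i ^ m ≤ w i ^ n :=
  pow_le_pow_of_le_one (hw.nonneg i) (hw.lt_one hδ i).le hm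

theorem summable_pow (hw : SmallOffOrigin n δ w) (hδ : δ < 1) {m : ℕ} (hm : n ≤ m) :
    Summable fun i => w i ^ m :=
  hw.summable.of_nonneg_of_le (fun i => pow_nonneg (hw.nonneg i) m) (hw.pow_le_pow hδ hm)

theorem tsum_pow_le (hw : SmallOffOrigin n δ w) (hδ : δ < 1) {m : ℕ} (hm : n ≤ m) :
    ∑' i, w i ^ m ≤ δ :=
  (Summable.tsum_le_tsum (hw.pow_le_pow hδ hm) (hw.summable_pow hδ hm) hw.summable).trans
    hw.tsum_le

end SmallOffOrigin

variable [AddCommGroup S]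

/-- The convolution of `Q` with `w^d`. -/
noncomputable def convPow (Q : S → ℝ) (d : ℕ) (w : S → ℝ) (i : S) : ℝ :=
  ∑' j, Q (i - j) * w j ^ d

open Classical in
/-- The recursion for boundary laws, normalized at the origin, in terms of the values off the
origin. -/
noncomputable def boundaryStep (Q : S → ℝ) (d : ℕ) (w : S → ℝ) (i : S) : ℝ :=
  if i = 0 then 0 else (Q i + convPow Q d w i) / (1 + convPow Q d w 0)

variable {Q : S → ℝ} {n : ℕ} {δ : ℝ} {w w' : S → ℝ}

theorem convPow_nonneg (hQ : ∀ j, 0 ≤ Q j) (d : ℕ) (hw : ∀ i, 0 ≤ w i) (i : S) :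
    0 ≤ convPow Q d w i :=
  tsum_nonneg fun j => mul_nonneg (hQ _) (pow_nonneg (hw j) d)

/-- The mean value bound for `(n + 1)`-th powers leaves `n`-th powers, whose sums are at most `δ`.
This is why smallness is measured with exponent `n = d - 1`. -/
theorem abs_convPow_sub_le (hQ : ∀ j, 0 ≤ Q j) (hQ1 : ∀ j, Q j ≤ 1) (hδ : δ < 1)
    (hw : SmallOffOrigin n δ w) (hw' : SmallOffOrigin n δ w') {ε : ℝ}
    (h : ∀ i, |w i - w' i| ≤ ε) (i : S) :
    |convPow Q (n + 1) w i - convPow Q (n + 1) w' i| ≤ 2 * (n + 1) * δ * ε := by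
  have hε : 0 ≤ ε := (abs_nonneg _).trans (h 0)
  have hs : ∀ {v : S → ℝ}, SmallOffOrigin n δ v →
      Summable fun j => Q (i - j) * v j ^ (n + 1) := fun hv =>
    summable_mul_of_le_one (fun j => hQ _) (fun j => hQ1 _)
      (fun j => pow_nonneg (hv.nonneg j) _) (hv.summable_pow hδ n.le_succ)
  have hterm : ∀ j, ‖Q (i - j) * w j ^ (n + 1) - Q (i - j) * w' j ^ (n + 1)‖ ≤
      ε * (n + 1) * (w j ^ n + w' j ^ n) := by
    intro j
    have h1 := abs_pow_sub_pow_le (w j) (w' j) (n + 1)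
    have h2 : max |w j| |w' j| ^ n ≤ w j ^ n + w' j ^ n := by
      rw [abs_of_nonneg (hw.nonneg j), abs_of_nonneg (hw'.nonneg j)]
      have := pow_nonneg (hw.nonneg j) n
      have := pow_nonneg (hw'.nonneg j) n
      rcases max_choice (w j) (w' j) with hm | hm <;> rw [hm] <;> linarith
    rw [← mul_sub, Real.norm_eq_abs, abs_mul, abs_of_nonneg (hQ _)]
    calc Q (i - j) * |w j ^ (n + 1) - w' j ^ (n + 1)|
        ≤ 1 * (|w j - w' j| * (n + 1 : ℕ) * max |w j| |w' j| ^ n) :=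
          mul_le_mul (hQ1 _) h1 (abs_nonneg _) zero_le_one
      _ ≤ ε * (n + 1) * (w j ^ n + w' j ^ n) := by
          rw [one_mul]
          push_cast
          gcongr
          exact h j
  have hsum : HasSum (fun j => ε * (n + 1) * (w j ^ n + w' j ^ n))
      (ε * (n + 1) * (∑' j, w j ^ n + ∑' j, w' j ^ n)) :=
    (hw.summable.hasSum.add hw'.summable.hasSum).mul_left _
  rw [convPow, convPow, ← Summable.tsum_sub (hs hw) (hs hw'), ← Real.norm_eq_abs]
  refine (tsum_of_norm_bounded hsum hterm).trans ?_
  calc _ ≤ ε * (n + 1) * (δ + δ) := by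
        gcongr
        · exact hw.tsum_le
        · exact hw'.tsum_le
    _ = _ := by ring

/-- Half of the budget `δ` goes to `3 ∑ Q ^ n` off the origin, the other half to the convolution,
which contributes at most `2 ((n + 1) δ) ^ n = 2 / 8 ^ n`. -/
theorem boundaryStep_smallOffOrigin (hQ : ∀ j, 0 ≤ Q j) (hQ1 : ∀ j, Q j ≤ 1) (hn : 3 ≤ n)
    (hδ : (n + 1) * δ = 1 / 8)
    (hq : ∀ s : Finset S, (0 : S) ∉ s → ∑ i ∈ s, Q i ^ n ≤ δ / 6)
    (hw : SmallOffOrigin n δ w) : SmallOffOrigin n δ (boundaryStep Q (n + 1) w) := by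
  classical
  have hn3 : (3 : ℝ) ≤ n := by exact_mod_cast hn
  have hδ0 : 0 < δ := by
    by_contra! h
    nlinarith
  have hδ1 : δ < 1 := by nlinarith
  have hF := convPow_nonneg hQ (n + 1) hw.nonneg
  have hden : 1 ≤ 1 + convPow Q (n + 1) w 0 := by linarith [hF 0]
  refine ⟨if_pos rfl, fun i => ?_, fun s => ?_⟩
  · rw [boundaryStep]
    split_ifs
    · exact le_rfl
    · exact div_nonneg (add_nonneg (hQ i) (hF i)) (by linarith)
  have hQB : ∀ t : Finset S, ∑ i ∈ t, Q i ^ n ≤ 2 := by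
    intro t
    have h1 : ∑ i ∈ t, Q i ^ n ≤ ∑ i ∈ insert 0 (t.erase 0), Q i ^ n :=
      Finset.sum_le_sum_of_subset_of_nonneg
        (fun i hi => by
          by_cases h0 : i = 0
          · simp [h0]
          · simp [h0, hi])
        fun i _ _ => pow_nonneg (hQ i) n
    rw [Finset.sum_insert (Finset.notMem_erase 0 t)] at h1
    have h2 := hq (t.erase 0) (Finset.notMem_erase 0 t)
    have h3 : Q 0 ^ n ≤ 1 := pow_le_one₀ (hQ 0) (hQ1 0)
    linarith
  have hpoint : ∀ i ∈ s, boundaryStep Q (n + 1) w i ^ n ≤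
      (if i = 0 then 0 else 3 * Q i ^ n) + (n + 1) ^ n * convPow Q (n + 1) w i ^ n := by
    intro i _
    rw [boundaryStep]
    split_ifs with h0
    · rw [zero_pow (by omega), zero_add]
      exact mul_nonneg (by positivity) (pow_nonneg (hF i) n)
    · calc _ ≤ (Q i + convPow Q (n + 1) w i) ^ n := by
            have := add_nonneg (hQ i) (hF i)
            gcongr
            exact div_le_self this hden
        _ ≤ 3 * Q i ^ n + ((n + 1) * convPow Q (n + 1) w i) ^ n :=
            add_pow_le_three_mul (hQ i) (hF i) (by omega)
        _ = _ := by rw [mul_pow]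
  have hconv : ∑ i ∈ s, convPow Q (n + 1) w i ^ n ≤ δ ^ n * 2 := by
    obtain ⟨m, rfl⟩ : ∃ m, n = m + 1 := ⟨n - 1, by omega⟩
    exact sum_pow_convolution_le hQ hQ1 (fun j => pow_nonneg (hw.nonneg j) _)
      (hw.summable_pow hδ1 (Nat.le_succ _)) (hw.tsum_pow_le hδ1 (Nat.le_succ _)) zero_le_two
      hQB s
  have hfirst : ∑ i ∈ s, (if i = 0 then 0 else 3 * Q i ^ n) ≤ δ / 2 := by
    have := hq (s.filter (¬ · = 0)) (by simp)
    rw [Finset.sum_ite, Finset.sum_const_zero, zero_add, ← Finset.mul_sum]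
    linarith
  -- This amounts to `32 (n + 1) ≤ 8 ^ n`, true from `n = 3` on and false for `n = 2`.
  have hsmall : (1 / 8 : ℝ) ^ n * 2 ≤ δ / 2 := by
    have h8 : ∀ m : ℕ, 3 ≤ m → 32 * (m + 1) ≤ 8 ^ m := by
      intro m hm
      induction m, hm using Nat.le_induction with
      | base => norm_num
      | succ m hm ih =>
        rw [pow_succ]
        omega
    have h8' : (32 : ℝ) * (n + 1) ≤ 8 ^ n := by exact_mod_cast h8 n hn
    have hδe : δ = 1 / 8 / (n + 1) := by
      rw [eq_div_iff (by positivity)]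
      linarith
    rw [hδe, one_div, inv_pow, inv_mul_eq_div, div_le_iff₀ (by positivity), div_div,
      div_mul_eq_mul_div, le_div_iff₀ (by positivity)]
    linarith
  calc ∑ i ∈ s, boundaryStep Q (n + 1) w i ^ n
      ≤ ∑ i ∈ s, ((if i = 0 then 0 else 3 * Q i ^ n) +
          (n + 1) ^ n * convPow Q (n + 1) w i ^ n) := Finset.sum_le_sum hpoint
    _ ≤ δ / 2 + (n + 1) ^ n * (δ ^ n * 2) := by
      rw [Finset.sum_add_distrib, ← Finset.mul_sum]
      gcongr
    _ = δ / 2 + (1 / 8) ^ n * 2 := by rw [← mul_assoc, ← mul_pow, hδ]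
    _ ≤ δ := by linarith

theorem abs_boundaryStep_sub_le (hQ : ∀ j, 0 ≤ Q j) (hQ1 : ∀ j, Q j ≤ 1)
    (hδ : (n + 1) * δ = 1 / 8) (hδ1 : δ < 1)
    (hw : SmallOffOrigin n δ w) (hw' : SmallOffOrigin n δ w')
    (hTw' : SmallOffOrigin n δ (boundaryStep Q (n + 1) w')) {ε : ℝ}
    (h : ∀ i, |w i - w' i| ≤ ε) (i : S) :
    |boundaryStep Q (n + 1) w i - boundaryStep Q (n + 1) w' i| ≤ ε / 2 := by
  have hε : 0 ≤ ε := (abs_nonneg _).trans (h 0)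
  by_cases h0 : i = 0
  · rw [boundaryStep, boundaryStep, if_pos h0, if_pos h0, sub_self, abs_zero]
    linarith
  set F := convPow Q (n + 1) w with hFdef
  set F' := convPow Q (n + 1) w' with hFdef'
  have hF0 : 0 ≤ F 0 := convPow_nonneg hQ (n + 1) hw.nonneg 0
  have hF0' : 0 ≤ F' 0 := convPow_nonneg hQ (n + 1) hw'.nonneg 0
  have hd : ∀ i, |F i - F' i| ≤ ε / 4 := fun i => by
    have := abs_convPow_sub_le hQ hQ1 hδ1 hw hw' h i
    calc _ ≤ _ := this
      _ = 2 * ((n + 1) * δ) * ε := by ring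
      _ = ε / 4 := by
        rw [hδ]
        ring
  have ht0 := hTw'.nonneg i
  have ht1 := (hTw'.lt_one hδ1 i).le
  set t := boundaryStep Q (n + 1) w' i with ht
  have hteq : t * (1 + F' 0) = Q i + F' i := by
    rw [ht, boundaryStep, if_neg h0, div_mul_cancel₀]
    linarith
  -- Written this way, numerator and denominator each contribute at most `ε / 4`, because `0 ≤ t ≤
  -- 1` and `1 + F 0 ≥ 1`.
  have hexp : boundaryStep Q (n + 1) w i - t =
      ((F i - F' i) - t * (F 0 - F' 0)) / (1 + F 0) := by
    rw [boundaryStep, if_neg h0, eq_div_iff (by linarith), sub_mul, div_mul_cancel₀ _ (by linarith)]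
    linarith
  rw [hexp, abs_div, abs_of_pos (show 0 < 1 + F 0 by linarith)]
  refine (div_le_self (abs_nonneg _) (by linarith)).trans ?_
  refine (abs_sub _ _).trans ?_
  rw [abs_mul, abs_of_nonneg ht0]
  have h1 := hd i
  have h2 : t * |F 0 - F' 0| ≤ 1 * (ε / 4) := mul_le_mul ht1 (hd 0) (abs_nonneg _) zero_le_one
  linarith

/-- Existence of a boundary law concentrated near the origin. -/
theorem exists_boundaryLaw (hQ : ∀ j, 0 < Q j) (hQ1 : ∀ j, Q j ≤ 1) (hQ0 : Q 0 = 1)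
    (hn : 3 ≤ n)
    (hq : ∀ s : Finset S, (0 : S) ∉ s → ∑ i ∈ s, Q i ^ n ≤ 1 / (48 * (n + 1))) :
    ∃ (u : S → ℝ) (N Z : ℝ), u 0 = 1 ∧ (∀ i, 0 < u i) ∧
      (∀ i, HasSum (fun j => Q (i - j) * u j ^ (n + 1)) (N * u i)) ∧
      HasSum (fun j => u j ^ (n + 2)) Z ∧ Z ≤ 1 + 1 / (8 * (n + 1)) := by
  classical
  have hn3 : (3 : ℝ) ≤ n := by exact_mod_cast hn
  set δ : ℝ := 1 / (8 * (n + 1)) with hδdef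
  have hδ : (n + 1) * δ = 1 / 8 := by
    rw [hδdef]
    field_simp
  have hδ0 : 0 < δ := by positivity
  have hδ1 : δ < 1 := by nlinarith
  have hq' : ∀ s : Finset S, (0 : S) ∉ s → ∑ i ∈ s, Q i ^ n ≤ δ / 6 := fun s hs =>
    (hq s hs).trans_eq (by rw [hδdef, div_div]; ring_nf)
  have hQ' := fun j => (hQ j).le
  have hmaps : ∀ w, SmallOffOrigin n δ w → SmallOffOrigin n δ (boundaryStep Q (n + 1) w) :=
    fun w hw => boundaryStep_smallOffOrigin hQ' hQ1 hn hδ hq' hw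
  have hzero : SmallOffOrigin n δ (0 : S → ℝ) :=
    ⟨rfl, fun _ => le_rfl, fun s => by
      simp only [Pi.zero_apply, zero_pow (show n ≠ 0 by omega), Finset.sum_const_zero]
      exact hδ0.le⟩
  obtain ⟨w, hw, hfix⟩ := exists_fixedPoint_of_half_contracting
    (p := SmallOffOrigin n δ) (T := boundaryStep Q (n + 1)) (w₀ := 0) (M := 1)
    (fun a w ha hlim => ⟨tendsto_nhds_unique (hlim 0) (by simp [(ha _).zero]),
      fun i => ge_of_tendsto' (hlim i) fun m => (ha m).nonneg i,
      fun s => le_of_tendsto' (tendsto_finsetSum s fun i _ => (hlim i).pow n)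
        fun m => (ha m).sum_le s⟩)
    hmaps
    (fun w w' ε hw hw' h => abs_boundaryStep_sub_le hQ' hQ1 hδ hδ1 hw hw' (hmaps _ hw') h)
    hzero fun i => by
      rw [Pi.zero_apply, zero_sub, abs_neg, abs_of_nonneg ((hmaps _ hzero).nonneg i)]
      exact ((hmaps _ hzero).lt_one hδ1 i).le
  have hF := convPow_nonneg hQ' (n + 1) hw.nonneg
  have hN : 0 < 1 + convPow Q (n + 1) w 0 := by linarith [hF 0]
  -- The equation at the origin then fixes the eigenvalue as `1 + convPow Q (n + 1) w 0`; off the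
  -- origin it is the fixed-point equation for `w`.
  let u : S → ℝ := fun i => if i = 0 then 1 else w i
  have hupow : ∀ m, m ≠ 0 → ∀ j, u j ^ m = (if j = 0 then 1 else 0) + w j ^ m := by
    intro m hm j
    simp only [u]
    split_ifs with h0
    · rw [h0, hw.zero, zero_pow hm, one_pow, add_zero]
    · rw [zero_add]
  have hwi : ∀ i, i ≠ 0 → (1 + convPow Q (n + 1) w 0) * w i = Q i + convPow Q (n + 1) w i := by
    intro i hi
    have := congrFun hfix i
    rw [boundaryStep, if_neg hi, div_eq_iff hN.ne'] at this
    rw [this, mul_comm]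
  refine ⟨u, 1 + convPow Q (n + 1) w 0, 1 + ∑' j, w j ^ (n + 2), if_pos rfl, fun i => ?_,
    fun i => ?_, ?_, ?_⟩
  · simp only [u]
    split_ifs with h0
    · exact one_pos
    · refine pos_of_mul_pos_right ?_ hN.le
      rw [hwi i h0]
      linarith [hQ i, hF i]
  · have h1 : HasSum (fun j => Q (i - j) * (if j = 0 then 1 else 0)) (Q i) := by
      refine (hasSum_ite_eq (0 : S) (Q i)).congr_fun fun j => ?_
      by_cases hj : j = 0 <;> simp [hj]
    have h2 : HasSum (fun j => Q (i - j) * w j ^ (n + 1)) (convPow Q (n + 1) w i) :=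
      (summable_mul_of_le_one (fun j => hQ' _) (fun j => hQ1 _)
        (fun j => pow_nonneg (hw.nonneg j) _) (hw.summable_pow hδ1 n.le_succ)).hasSum
    have h3 := h1.add h2
    simp only [← mul_add, ← hupow (n + 1) n.succ_ne_zero] at h3
    convert h3 using 1
    simp only [u]
    split_ifs with h0
    · rw [h0, hQ0, mul_one]
    · exact hwi i h0
  · simp only [hupow (n + 2) (by omega)]
    exact (hasSum_ite_eq (0 : S) (1 : ℝ)).add (hw.summable_pow hδ1 (by omega)).hasSum
  · have := hw.tsum_pow_le hδ1 (m := n + 2) (by omega)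
    linarith

end BoundaryLawExistence

/-! ### Smallness of the transfer operator for large degree. -/

section LargeDegree

open Filter Topology

theorem tendsto_sub_one_div_add_one :
    Tendsto (fun d : ℕ => ((d : ℝ) - 1) / (d + 1)) atTop (𝓝 1) := by
  have h : Tendsto (fun d : ℕ => 1 - 2 / ((d : ℝ) + 1)) atTop (𝓝 (1 - 0)) :=
    tendsto_const_nhds.sub
      (tendsto_const_nhds.div_atTop (tendsto_natCast_atTop_atTop.atTop_add tendsto_const_nhds))
  rw [sub_zero] at h
  refine h.congr fun d => ?_
  have : (d : ℝ) + 1 ≠ 0 := by positivity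
  field_simp
  ring

/-- Since `(d - 1) * thresholdBeta A d` is asymptotic to `A log d`, the exponential times `d` is
`exp (log d * (1 - A v + o(1)) + s₀ v)`, which tends to zero exactly because `A v > 1`. -/
theorem eventually_exp_thresholdBeta_le {A v : ℝ} (hA : 0 < A) (hAv : 1 < A * v) (s₀ M : ℝ) :
    ∀ᶠ d : ℕ in atTop, s₀ ≤ ((d : ℝ) - 1) * thresholdBeta A d ∧
      Real.exp (-(((d : ℝ) - 1) * thresholdBeta A d - s₀) * v) * M ≤ 1 / (48 * d) := by
  have hlog : Tendsto (fun d : ℕ => Real.log d) atTop atTop :=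
    Real.tendsto_log_atTop.comp tendsto_natCast_atTop_atTop
  have hL : ∀ d : ℕ, ((d : ℝ) - 1) * thresholdBeta A d =
      Real.log d * (A * (((d : ℝ) - 1) / (d + 1))) := fun d => by
    rw [thresholdBeta]
    ring
  have h1 : Tendsto (fun d : ℕ => ((d : ℝ) - 1) * thresholdBeta A d) atTop atTop := by
    simp only [hL]
    refine hlog.atTop_mul_pos (C := A) hA ?_
    simpa using tendsto_sub_one_div_add_one.const_mul A
  have h2 : Tendsto (fun d : ℕ => Real.log d * (1 - A * (((d : ℝ) - 1) / (d + 1)) * v))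
      atTop atBot := by
    refine hlog.atTop_mul_neg (C := 1 - A * v) (by linarith) ?_
    simpa using (tendsto_const_nhds (x := (1 : ℝ))).sub
      ((tendsto_sub_one_div_add_one.const_mul A).mul_const v)
  have h3 : Tendsto (fun d : ℕ => Real.exp (Real.log d * (1 - A * (((d : ℝ) - 1) / (d + 1)) * v)
      + s₀ * v) * (48 * M)) atTop (𝓝 0) := by
    simpa using (Real.tendsto_exp_atBot.comp (h2.atBot_add tendsto_const_nhds)).mul_const (48 * M)
  filter_upwards [h1.eventually_ge_atTop s₀, h3.eventually_le_const one_pos,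
    eventually_ge_atTop 1] with d hd1 hd2 hd3
  refine ⟨hd1, ?_⟩
  have hd0 : (0 : ℝ) < d := by exact_mod_cast hd3
  rw [le_div_iff₀ (by positivity)]
  refine le_trans (le_of_eq ?_) hd2
  have : Real.log d * (1 - A * (((d : ℝ) - 1) / (d + 1)) * v) + s₀ * v =
      Real.log d + -(((d : ℝ) - 1) * thresholdBeta A d - s₀) * v := by
    rw [hL]
    ring
  rw [this, Real.exp_add, Real.exp_log hd0]
  ring

/-- Split `L U = (L - s₀) U + s₀ U`: the gap `U ≥ v` off the origin makes the first part a uniform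
gain, and the second keeps the sum finite. -/
theorem sum_transferOp_pow_le {k : ℕ} {U : Spin k → ℝ} {v : ℝ} (hv : 0 ≤ v)
    (hU : ∀ j, j ≠ 0 → v ≤ U j) {s₀ : ℝ} (hs : Summable fun j => Real.exp (-s₀ * U j))
    {n : ℕ} {β L : ℝ} (hL : s₀ ≤ L) (hβ : L ≤ n * β) {s : Finset (Spin k)} (h0 : 0 ∉ s) :
    ∑ j ∈ s, transferOp U β j ^ n ≤
      Real.exp (-(L - s₀) * v) * ∑' j, Real.exp (-s₀ * U j) := by
  calc ∑ j ∈ s, transferOp U β j ^ n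
      ≤ ∑ j ∈ s, Real.exp (-(L - s₀) * v) * Real.exp (-s₀ * U j) := by
        refine Finset.sum_le_sum fun j hj => ?_
        have hj0 : j ≠ 0 := by
          rintro rfl
          exact h0 hj
        have hUj := hU j hj0
        rw [transferOp, ← Real.exp_nat_mul, ← Real.exp_add, Real.exp_le_exp]
        have h1 : L * U j ≤ n * β * U j := mul_le_mul_of_nonneg_right hβ (hv.trans hUj)
        have h2 : (L - s₀) * v ≤ (L - s₀) * U j :=
          mul_le_mul_of_nonneg_left hUj (sub_nonneg.2 hL)
        linarith
    _ = Real.exp (-(L - s₀) * v) * ∑ j ∈ s, Real.exp (-s₀ * U j) := (Finset.mul_sum _ _ _).symm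
    _ ≤ _ := by
        gcongr
        exact hs.sum_le_tsum s fun j _ => (Real.exp_pos _).le

theorem summable_exp_of_memℓp {k : ℕ} {U : Spin k → ℝ} {β : ℝ} {d : ℕ}
    (h : Memℓp (transferOp U β) (((d : ℝ≥0∞) + 1) / 2)) :
    Summable fun j => Real.exp (-(((d : ℝ) + 1) / 2 * β) * U j) := by
  have hr : (((d : ℝ≥0∞) + 1) / 2).toReal = ((d : ℝ) + 1) / 2 := by
    rw [ENNReal.toReal_div, ENNReal.toReal_add (by simp) (by simp)]
    simp
  have hpos : 0 < (((d : ℝ≥0∞) + 1) / 2).toReal := by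
    rw [hr]
    positivity
  refine (h.summable hpos).congr fun j => ?_
  rw [hr, transferOp, Real.norm_of_nonneg (Real.exp_pos _).le, ← Real.exp_mul]
  ring_nf

end LargeDegree

end TreeGibbs

/-! ### Translated boundary laws and their one-site marginals. -/

theorem theorem4p2 {k : ℕ} (hk : 1 ≤ k) (U : TreeGibbs.Spin k → ℝ)
    (hU_nonneg : ∀ j, 0 ≤ U j) (hU_even : Function.Even U) (hU_zero : U 0 = 0)
    (v : ℝ) (hv_def : v = ⨅ j : {j : TreeGibbs.Spin k // j ≠ 0}, U j) (hv : 0 < v)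
    (A : ℝ) (hA : 1 / v < A)
    (hQ : ∃ d : ℕ, 2 ≤ d ∧
      Memℓp (TreeGibbs.transferOp U (TreeGibbs.thresholdBeta A d)) (((d : ℝ≥0∞) + 1) / 2)) :
    ∃ d₀ : ℕ, 2 ≤ d₀ ∧ ∃ C : ℝ, 0 < C ∧
      ∀ d : ℕ, d₀ ≤ d →
      ∀ (V : Type*) (G : SimpleGraph V) [G.LocallyFinite],
        G.IsTree → G.IsRegularOfDegree (d + 1) →
      ∀ β : ℝ, TreeGibbs.thresholdBeta A d ≤ β →
      ∃ μ : TreeGibbs.Spin k → MeasureTheory.Measure (TreeGibbs.Config V k),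
        Function.Injective μ ∧
        ∀ i : TreeGibbs.Spin k,
          TreeGibbs.IsGibbsMeasure G (TreeGibbs.transferOp U β)
            (TreeGibbs.transferOp_even hU_even β) (μ i) ∧
          TreeGibbs.IsAutomorphismInvariant G (μ i) ∧
          ∀ x : V, 0 < (μ i).real {σ | σ x = i} ∧
            (μ i).real {σ | σ x ≠ i} / (μ i).real {σ | σ x = i} ≤ C / d := by
  have hUv : ∀ j, j ≠ 0 → v ≤ U j := fun j hj => hv_def ▸
    ciInf_le (f := fun j : {j : TreeGibbs.Spin k // j ≠ 0} => U j)
      ⟨0, Set.forall_mem_range.2 fun j => hU_nonneg j⟩ ⟨j, hj⟩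
  have hA0 : 0 < A := (one_div_pos.2 hv).trans hA
  have hAv : 1 < A * v := (div_lt_iff₀ hv).1 hA
  obtain ⟨d₁, -, hmem⟩ := hQ
  have hs := TreeGibbs.summable_exp_of_memℓp hmem
  set s₀ := ((d₁ : ℝ) + 1) / 2 * TreeGibbs.thresholdBeta A d₁
  obtain ⟨d₂, hd₂⟩ := Filter.eventually_atTop.1 (TreeGibbs.eventually_exp_thresholdBeta_le hA0 hAv
    s₀ (∑' j, Real.exp (-s₀ * U j)))
  -- `4 ≤ d` gives `3 ≤ n` for `n = d - 1`; `1 / 8` comes from `Z - 1 ≤ 1 / (8 d)`.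
  refine ⟨max d₂ 4, (by norm_num : 2 ≤ 4).trans (le_max_right _ _), 1 / 8, by norm_num, ?_⟩
  intro d hd V G _ hG hreg β hβ
  obtain ⟨hL, hexp⟩ := hd₂ d ((le_max_left _ _).trans hd)
  obtain ⟨n, rfl⟩ : ∃ n, d = n + 1 :=
    ⟨d - 1, by have := (le_max_right d₂ 4).trans hd; omega⟩
  have hn : 3 ≤ n := by
    have := (le_max_right d₂ 4).trans hd
    omega
  have hn3 : (3 : ℝ) ≤ n := by exact_mod_cast hn
  push_cast at hL hexp
  rw [add_sub_cancel_right] at hL hexp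
  have hβ0 : 0 ≤ β := by
    refine le_trans ?_ hβ
    exact div_nonneg (mul_nonneg hA0.le (Real.log_natCast_nonneg _)) (by positivity)
  have hQpos : ∀ j, 0 < TreeGibbs.transferOp U β j := fun j => Real.exp_pos _
  obtain ⟨u, N, Z, hu0, hupos, hN, hZ, hZle⟩ := TreeGibbs.exists_boundaryLaw
    (Q := TreeGibbs.transferOp U β) hQpos
    (fun j => Real.exp_le_one_iff.2
      (by have := mul_nonneg hβ0 (hU_nonneg j); linarith))
    (by simp [TreeGibbs.transferOp, hU_zero]) hn
    (fun s h0 => (TreeGibbs.sum_transferOp_pow_le hv.le hUv hs hL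
      (mul_le_mul_of_nonneg_left hβ n.cast_nonneg) h0).trans hexp)
  have hZ1 : 1 ≤ Z := by
    have := le_hasSum hZ 0 fun j _ => (pow_pos (hupos j) _).le
    rwa [hu0, one_pow] at this
  have hZ2 : Z < 2 := by
    have : 1 / (8 * ((n : ℝ) + 1)) < 1 := by
      rw [div_lt_one (by positivity)]
      linarith
    linarith
  -- The weight depends only on spin differences, so translates of a boundary law are boundary laws
  -- with the same `N` and `Z`.
  have hex := fun i : TreeGibbs.Spin k => TreeGibbs.exists_isGibbsMeasure_of_boundaryLaw G hG hreg
    (TreeGibbs.transferOp_even hU_even β) hQpos (u := fun j => u (j - i)) (N := N) (Z := Z)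
    (fun j => hupos _)
    (fun j => by
      have := (Equiv.subRight i).hasSum_iff.2 (hN (j - i))
      simpa only [Function.comp_def, Equiv.subRight_apply, sub_sub_sub_cancel_right] using this)
    ((Equiv.subRight i).hasSum_iff.2 hZ)
  choose μ hgibbs hinv hmarg using hex
  have hdiag : ∀ i x, (μ i).real {σ | σ x = i} = 1 / Z := fun i x => by
    rw [hmarg, sub_self, hu0, one_pow]
  have hcompl : ∀ i x, (μ i).real {σ | σ x ≠ i} = 1 - 1 / Z := fun i x => by
    have := (hgibbs i).isProbabilityMeasure
    have hms : MeasurableSet {σ : TreeGibbs.Config V k | σ x = i} :=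
      measurableSet_eq_fun (measurable_pi_apply x) measurable_const
    rw [← hdiag i x, ← MeasureTheory.probReal_compl_eq_one_sub hms]
    rfl
  refine ⟨μ, fun i i' hii => ?_, fun i => ⟨hgibbs i, hinv i, fun x => ⟨?_, ?_⟩⟩⟩
  -- One measure cannot give two different spins at `x` probability `1 / Z > 1 / 2` each.
  · by_contra hne
    obtain ⟨x⟩ := hG.connected.nonempty
    have := (hgibbs i).isProbabilityMeasure
    have hle : (μ i).real {σ | σ x = i'} ≤ (μ i).real {σ | σ x ≠ i} :=
      MeasureTheory.measureReal_mono fun σ hσ hσ' => hne (hσ'.symm.trans hσ)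
    rw [hcompl, hii, hdiag] at hle
    have : 1 / 2 < 1 / Z := one_div_lt_one_div_of_lt (by linarith) hZ2
    linarith
  · rw [hdiag]
    positivity
  · rw [hdiag, hcompl]
    have : (1 - 1 / Z) / (1 / Z) = Z - 1 := by
      field_simp
    rw [this]
    calc Z - 1 ≤ 1 / (8 * ((n : ℝ) + 1)) := by linarith
      _ = 1 / 8 / ((n + 1 : ℕ) : ℝ) := by
        rw [div_div]
        push_cast
        rfl
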